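/- **Setting.** For each $N\ge 1$ consider $N$ periodic cells, indexed by $j\in\mathbb Z/N\mathbb Z$, of size $h=1/N$, at $x_j=j/N$ (periodic with period 1). The state of a cell is $(z_j,\rho_j)\in\mathbb A=\{-1,1\}\times[0,\infty)$. The flow from cell $j$ to cell $j+1$ is $\Psi_{j+1/2}=\rho_j\max\{z_j,0\}+\rho_{j+1}\min\{z_{j+1},0\}$, and cell $j$ switches its direction $z_j$ at a measurable rate $\gamma_j=\gamma_j^N(\vec z,\vec\rho)\ge 0$. For $t>0$ let $\mathcal F^N(t)$ be a probability law on $\mathbb A^N$ with $\rho_j$ and $\gamma_j(1+\rho_j)$ integrable for all $j$, which satisfies the weak master equation $$\frac{d}{dt}\langle\mathcal F^N,\varphi\rangle=-\Big\langle\mathcal F^N,\sum_i(\Psi_{i+1/2}-\Psi_{i-1/2})\,\partial_{\rho_i}\varphi\Big\rangle+\frac1N\sum_i\big\langle\mathcal F^N,\gamma_i\,(\varphi(-z_i,\hat z_i,\vec\rho)-\varphi(\vec z,\vec\rho))\big\rangle$$ for all $t>0$ and all functions $\varphi=\psi(z_j,\rho_j)$ of the state of one cell, with $\psi(z,\cdot)\in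 C^1$ and $\partial_\rho\psi$ bounded. Let $\mathbf f^h(x_j,\cdot,\cdot,t)$ be the $j$-th one-cell marginal of $\mathcal F^N(t)$ and $\tilde{\mathbf f}^h(x_j,z,\rho,t)=\mathbf f^h(x_j,z,\rho,t/h)$. For a measure $\mathbf g$ on $\mathbb A$ put $p_\pm=\int\mathbf g(\pm1,d\rho)$, $\bar\rho_\pm=\int\rho\,\mathbf g(\pm1,d\rho)$, $\bar\rho=\bar\rho_++\bar\rho_-$ and $u=p_+-p_-$. Below, "locally uniformly" means: as $h\to0$, along all $x_j\to x\in\mathbb R$ and $t'\to t>0$. **Assumptions.** 1. (Propagation of chaos.) $\mathcal F^N(t)$ is the product of its one-cell marginals, for all $N$ and $t>0$. 2. (Smooth convergence.) There are measures $\tilde{\mathbf f}(x,\cdot,\cdot,t)$ on $\mathbb A$ with finite mass and finite first moment in $\rho$ such that $\langle\tilde{\mathbf f}^h(x_j,\cdot,\cdot,t'),\varphi\rangle\to\langle\tilde{\mathbf f}(x,\cdot,\cdot,t),\varphi\rangle$ locally uniformly for all continuous $\varphi$ on $\mathbb A$ of at most linear growth, and the difference quotients $\big(\bar\rho^h_\pm(x_{j+1},t')-\bar\rho^h_\pm(x_j,t')\big)/h$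 of the moments $\bar\rho^h_\pm$ of $\tilde{\mathbf f}^h$ converge locally uniformly. 3. (Mean-field limit for the rates.) For one-cell laws $\mathbf g^h(x_i,\cdot,\cdot,t)$ let $\bar\gamma^h[\mathbf g^h](x_j,z_j,\rho_j,t)=\big\langle\prod_{i\ne j}\mathbf g^h(x_i,z_i,\rho_i,t),\gamma_j\big\rangle$. There is $\bar\gamma$ such that $\bar\gamma^h[\tilde{\mathbf f}^h](x_j,z,\rho',t')\to\bar\gamma(x,z,\rho,t)$ locally uniformly and along all $\rho'\to\rho$; moreover near each $(x,t)$, $t>0$, for all small $h$, $\bar\gamma^h[\tilde{\mathbf f}^h](x_j,z,\rho,t')\le C(1+\rho)$ for all $z,\rho$, with $C$ independent of $h$. **Conclusion.** Let $p_\pm,\bar\rho,u$ be the moments of $\tilde{\mathbf f}$. For all $x\in\mathbb R$ and $t>0$, $$\tilde{\mathbf f}(x,\pm1,\rho,t)=p_\pm(x,t)\,\delta(\rho-\bar\rho(x,t)),\qquad p_\pm=\frac{1\pm u}2,$$ the derivatives $\partial_t\bar\rho$, $\partial_x(\bar\rho u)$, $\partial_tu$ exist, and $$\partial_t\bar\rho+\partial_x(\bar\rho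 u)=0,\qquad\partial_tu=\gamma_t\,(u_{\rm coll}-u),$$ where $\gamma_t=\tilde\gamma_-+\tilde\gamma_+$, $u_{\rm coll}=\dfrac{\tilde\gamma_--\tilde\gamma_+}{\tilde\gamma_-+\tilde\gamma_+}$ and $\tilde\gamma_\pm(x,t)=\bar\gamma(x,\pm1,\bar\rho(x,t),t)$ (the right-hand side of the equation for $u$ is read as $0$ where $\gamma_t=0$). If moreover the mean-field limit depends on the one-cell laws only through their limit, that is, if $\bar\gamma^h[\mathbf g^h]\to\bar\gamma$ in the sense of the first part of 3 for all one-cell probability laws $\mathbf g^h$ with finite first moments that converge to $\tilde{\mathbf f}$ in the sense of the first part of 2, then $\bar\gamma$ is also the limit of the effective rates of the limit laws: $\bar\gamma^h[\mathbf g^h]\to\bar\gamma$ in the same sense for $\mathbf g^h(x_i,z,\rho,t)=p_z(x_i,t)\,\delta(\rho-\bar\rho(x_i,t))$. -/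

import Mathlib

open MeasureTheory Filter Topology
open scoped NNReal

noncomputable section

namespace Sweeping

/-! ### The sweeping process on `N` periodic cells -/

/-- State `(z, ρ)` of one cell: direction `z ∈ {-1, 1}` and density `ρ ≥ 0`. -/
abbrev Cell : Type := ℤˣ × ℝ≥0

/-- State of all the cells; cells are indexed by `ℤ / N`, i.e. periodically. -/
abbrev Config (N : ℕ) : Type := ZMod N → Cell

/-- The direction `z = ±1` as a real number. -/
def dir (a : Cell) : ℝ := ((a.1 : ℤ) : ℝ)

/-- The density of a cell as a real number. -/
def dens (a : Cell) : ℝ := (a.2 : ℝ)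

/-- The flow `Ψ_{j+1/2}` from cell `j` to cell `j + 1`. -/
def flux {N : ℕ} (s : Config N) (j : ZMod N) : ℝ :=
  dens (s j) * max (dir (s j)) 0 + dens (s (j + 1)) * min (dir (s (j + 1))) 0

/-- The configuration in which the direction of cell `j` has been switched. -/
def switch {N : ℕ} (s : Config N) (j : ZMod N) : Config N :=
  Function.update s j (-(s j).1, (s j).2)

/-- Evaluation of a function of the directions and the densities at a configuration. -/
def evalAt {N : ℕ} (φ : (ZMod N → ℤˣ) → (ZMod N → ℝ) → ℝ) (s : Config N) : ℝ :=
  φ (fun k => (s k).1) (fun k => dens (s k))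

/-- The partial derivative `∂φ/∂ρ_i` at a configuration. -/
def partialDens {N : ℕ} (φ : (ZMod N → ℤˣ) → (ZMod N → ℝ) → ℝ) (i : ZMod N)
    (s : Config N) : ℝ :=
  deriv (fun r : ℝ => φ (fun k => (s k).1) (Function.update (fun k => dens (s k)) i r))
    (dens (s i))

/-- The Markov generator of the time-continuous sweeping process at the kinetic time scale:
`L φ = - ∑ i, (Ψ_{i+1/2} - Ψ_{i-1/2}) ∂φ/∂ρ_i + (1/N) ∑ i, γ_i (φ ∘ switch_i - φ)`. -/
def generator {N : ℕ} [NeZero N] (γ : ZMod N → Config N → ℝ)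
    (φ : (ZMod N → ℤˣ) → (ZMod N → ℝ) → ℝ) (s : Config N) : ℝ :=
  -(∑ i, (flux s i - flux s (i - 1)) * partialDens φ i s)
    + (1 / (N : ℝ)) * ∑ i, γ i s * (evalAt φ (switch s i) - evalAt φ s)

/-- One-cell test functions: `C¹` in the density with a bounded derivative. -/
def IsTest (ψ : ℤˣ → ℝ → ℝ) : Prop :=
  (∀ z, ContDiff ℝ 1 (ψ z)) ∧ ∃ C : ℝ, ∀ z r, |deriv (ψ z) r| ≤ C

/-- A function of the state of cell `j`, seen as a function of all cells. -/
def oneCell {N : ℕ} (j : ZMod N) (ψ : ℤˣ → ℝ → ℝ) :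
    (ZMod N → ℤˣ) → (ZMod N → ℝ) → ℝ :=
  fun z ρ => ψ (z j) (ρ j)

/-- The weak form `d/dt ⟨F, φ⟩ = ⟨F, L φ⟩` of the master equation at positive times, tested
against the functions `φ` of a single cell, together with the finiteness of the pairings that
occur in it. A law that satisfies the weak form for all test functions satisfies this; it is all
that enters the evolution of the one-cell marginals. (For test functions of several cells the
equation creates correlations between neighbours and would exclude most product laws.) -/
structure SolvesMasterEquation {N : ℕ} [NeZero N] (γ : ZMod N → Config N → ℝ)
    (F : ℝ → Measure (Config N)) : Prop where
  isProbabilityMeasure : ∀ t, 0 < t → IsProbabilityMeasure (F t)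
  integrable_dens : ∀ t, 0 < t → ∀ i, Integrable (fun s => dens (s i)) (F t)
  integrable_rate : ∀ t, 0 < t → ∀ i, Integrable (fun s => γ i s * (1 + dens (s i))) (F t)
  weak_form : ∀ t, 0 < t → ∀ (j : ZMod N) (ψ : ℤˣ → ℝ → ℝ), IsTest ψ →
    HasDerivAt (fun τ => ∫ s, evalAt (oneCell j ψ) s ∂(F τ))
      (∫ s, generator γ (oneCell j ψ) s ∂(F t)) t

/-- The one-cell marginal of the law of a configuration. -/
def marginal {N : ℕ} (μ : Measure (Config N)) (j : ZMod N) : Measure Cell :=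
  μ.map (fun s => s j)

/-- Propagation of chaos: the joint law is the product of its one-cell marginals. -/
def PropagationOfChaos {N : ℕ} [NeZero N] (F : ℝ → Measure (Config N)) : Prop :=
  ∀ t, 0 < t → F t = Measure.pi (fun j => marginal (F t) j)

/-- The effective rate `⟨∏_{i ≠ j} g_i, γ_j⟩` at the state `(z, ρ)` of cell `j`. The coordinate
`j` of the configuration is overwritten, so the probability measure `g_j` is integrated out. -/
def effRate {N : ℕ} [NeZero N] (γ : ZMod N → Config N → ℝ) (g : ZMod N → Measure Cell)
    (j : ZMod N) (z : ℤˣ) (ρ : ℝ≥0) : ℝ :=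
  ∫ s, γ j (Function.update s j (z, ρ)) ∂(Measure.pi g)

/-! ### Families indexed by the number of cells `N`, with cell size `h = 1 / N` -/

/-- One-cell laws `g N j t` for each number of cells `N`, cell `j` and macroscopic time `t`. -/
abbrev Profile : Type := (N : ℕ+) → ZMod N → ℝ → Measure Cell

/-- The one-cell marginals at the hydrodynamic time scale: time `t / h = N t`. -/
def rescaled (F : (N : ℕ+) → ℝ → Measure (Config N)) : Profile :=
  fun N j t => marginal (F N ((N : ℝ) * t)) j

/-- `N → ∞`, `x_j = j / N → x` and `t' → t`, for the triples `(N, j, t')`. -/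
def hydroFilter (x t : ℝ) : Filter (ℕ+ × ℤ × ℝ) :=
  comap (fun q => (q.1, (q.2.1 : ℝ) / (q.1 : ℝ), q.2.2)) (atTop ×ˢ 𝓝 x ×ˢ 𝓝 t)

/-- Convergence of functions on the space-time grid to a function of `(x, t)`, `t > 0`, along
all grid points and times that converge to `(x, t)` (locally uniform convergence). -/
def GridTendsto (a : (N : ℕ+) → ZMod N → ℝ → ℝ) (b : ℝ → ℝ → ℝ) : Prop :=
  ∀ x t, 0 < t →
    Tendsto (fun q : ℕ+ × ℤ × ℝ => a q.1 (q.2.1 : ZMod q.1) q.2.2) (hydroFilter x t) (𝓝 (b x t))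

/-- Convergence of one-cell laws to `f x t`, tested against continuous functions of at most
linear growth in the density: narrow convergence together with convergence of first moments. -/
structure ProfileTendsto (g : Profile) (f : ℝ → ℝ → Measure Cell) : Prop where
  integrable : ∀ x t, 0 < t → Integrable (fun a => 1 + dens a) (f x t)
  tendsto : ∀ φ : ℤˣ → ℝ≥0 → ℝ, (∀ z, Continuous (φ z)) →
    (∃ C : ℝ, ∀ z (ρ : ℝ≥0), |φ z ρ| ≤ C * (1 + (ρ : ℝ))) →
    GridTendsto (fun N j t => ∫ a, φ a.1 a.2 ∂(g N j t)) (fun x t => ∫ a, φ a.1 a.2 ∂(f x t))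

/-! ### Moments of one-cell laws -/

/-- The measure `μ(z, ·)` on the densities. -/
def component (μ : Measure Cell) (z : ℤˣ) : Measure ℝ≥0 :=
  (μ.restrict (Prod.fst ⁻¹' {z})).map Prod.snd

/-- `p_z = ∫ μ(z, dρ)`. -/
def prob (μ : Measure Cell) (z : ℤˣ) : ℝ := (component μ z).real Set.univ

/-- `ρ̄_z = ∫ ρ μ(z, dρ)`. -/
def meanDensOf (μ : Measure Cell) (z : ℤˣ) : ℝ := ∫ ρ : ℝ≥0, (ρ : ℝ) ∂(component μ z)

/-- `ρ̄ = ρ̄_+ + ρ̄_-`. -/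
def meanDens (μ : Measure Cell) : ℝ := meanDensOf μ 1 + meanDensOf μ (-1)

/-- `u = p_+ - p_-`. -/
def velocity (μ : Measure Cell) : ℝ := prob μ 1 - prob μ (-1)

/-- Smooth convergence of one-cell laws: `ProfileTendsto`, and the partial mean densities `ρ̄_±`
converge in `C¹` with respect to the space variable, i.e. their difference quotients converge. -/
structure SmoothTendsto (g : Profile) (f : ℝ → ℝ → Measure Cell) : Prop extends
    ProfileTendsto g f where
  space_deriv : ∀ z : ℤˣ, ∃ D : ℝ → ℝ → ℝ,
    GridTendsto
      (fun N j t => (meanDensOf (g N (j + 1) t) z - meanDensOf (g N j t) z) / (1 / (N : ℝ))) D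

/-! ### Mean-field limit of the rates -/

/-- `γ̄^h(x_j, z, ρ', t') → γ̄(x, z, ρ, t)` as `h → 0`, `x_j → x`, `ρ' → ρ`, `t' → t`, where
`γ̄^h` is the effective rate for the one-cell laws `g`. -/
def RateTendsto (γ : (N : ℕ+) → ZMod N → Config N → ℝ) (g : Profile)
    (γbar : ℝ → ℤˣ → ℝ≥0 → ℝ → ℝ) : Prop :=
  ∀ (x t : ℝ) (z : ℤˣ) (ρ : ℝ≥0), 0 < t →
    Tendsto
      (fun q : (ℕ+ × ℤ × ℝ) × ℝ≥0 =>
        effRate (γ q.1.1) (fun i => g q.1.1 i q.1.2.2) (q.1.2.1 : ZMod q.1.1) z q.2)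
      (hydroFilter x t ×ˢ 𝓝 ρ) (𝓝 (γbar x z ρ t))

/-- The mean-field limit for the rates: the effective rates converge, and, locally uniformly in
space and time, they grow at most linearly in the density. -/
structure MeanFieldLimit (γ : (N : ℕ+) → ZMod N → Config N → ℝ) (g : Profile)
    (γbar : ℝ → ℤˣ → ℝ≥0 → ℝ → ℝ) : Prop where
  tendsto : RateTendsto γ g γbar
  growth : ∀ x t, 0 < t → ∃ C : ℝ, ∀ᶠ q in hydroFilter x t, ∀ (z : ℤˣ) (ρ : ℝ≥0),
    effRate (γ q.1) (fun i => g q.1 i q.2.2) (q.2.1 : ZMod q.1) z ρ ≤ C * (1 + (ρ : ℝ))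

/-- The mean-field limit of the rates depends on the one-cell laws only through their limit `f`:
all one-cell laws that converge to `f` give the same limit of the effective rates. -/
def MeanFieldStable (γ : (N : ℕ+) → ZMod N → Config N → ℝ) (f : ℝ → ℝ → Measure Cell)
    (γbar : ℝ → ℤˣ → ℝ≥0 → ℝ → ℝ) : Prop :=
  ∀ g : Profile,
    (∀ N j t, 0 < t → IsProbabilityMeasure (g N j t) ∧ Integrable dens (g N j t)) →
    ProfileTendsto g f → RateTendsto γ g γbar

/-- The one-cell laws `p_z(x_i, t) δ(ρ - ρ̄(x_i, t))` on the grid `x_i = i / N`, with the moments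
`p_±`, `ρ̄` of `f`. -/
def diracProfile (f : ℝ → ℝ → Measure Cell) : Profile := fun N i t =>
  ∑ z : ℤˣ, ENNReal.ofReal (prob (f ((i.val : ℝ) / (N : ℝ)) t) z) •
    Measure.dirac (z, (meanDens (f ((i.val : ℝ) / (N : ℝ)) t)).toNNReal)

/-- `γ̃_±(x, t) = γ̄(x, ±1, ρ̄(x, t), t)`. -/
def limitRate (γbar : ℝ → ℤˣ → ℝ≥0 → ℝ → ℝ) (f : ℝ → ℝ → Measure Cell) (z : ℤˣ)
    (x t : ℝ) : ℝ :=
  γbar x z (meanDens (f x t)).toNNReal t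

/-- `γ_t = γ̃_- + γ̃_+`. -/
def totalRate (γbar : ℝ → ℤˣ → ℝ≥0 → ℝ → ℝ) (f : ℝ → ℝ → Measure Cell) (x t : ℝ) : ℝ :=
  limitRate γbar f (-1) x t + limitRate γbar f 1 x t

/-- `u_coll = (γ̃_- - γ̃_+) / (γ̃_- + γ̃_+)`; where both rates vanish the value is irrelevant, as
`u_coll` is only used multiplied by `γ_t`. -/
def collVelocity (γbar : ℝ → ℤˣ → ℝ≥0 → ℝ → ℝ) (f : ℝ → ℝ → Measure Cell) (x t : ℝ) : ℝ :=
  (limitRate γbar f (-1) x t - limitRate γbar f 1 x t) /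
    (limitRate γbar f (-1) x t + limitRate γbar f 1 x t)

end Sweeping

end

noncomputable section

namespace Sweeping

/-! ### Convergence on the space-time grid -/

/-! The time change `t ↦ N t` puts a factor `N` in front of the generator, and the three assertions
come from testing the accelerated one-cell equations with three kinds of functions.

For `ψ(ρ)` independent of the direction the switching term cancels. By chaos the neighbours of cell
`j` are independent of it, so the generator integrates to `(ρ̄₊(x_{j-1}) + ρ̄₋(x_{j+1})) ⟨ψ'⟩ - ⟨ρ
ψ'⟩`, which tends to `⟨(ρ̄ - ρ) ψ'⟩`. Multiplied by `N` this is the time derivative of a convergent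
quantity, so the limit must vanish (`GridTendsto.tendsto_deriv_div_eq_zero`). With `ψ` strictly
convex and minimal at `ρ̄`, the integrand has a sign and vanishes only at `ρ = ρ̄`: the limit law is
monokinetic (`ae_eq_meanDens`).

For `ψ = ρ` the generator is a sum of differences of `ρ̄_±` between neighbouring cells, and the
factor `N` makes them difference quotients. Their limits are the space derivatives of `ρ̄_±`
(`GridTendsto.hasDerivAt_space`), and limits of time derivatives are time derivatives of limits
(`GridTendsto.hasDerivAt_time`). Monokineticity turns the flux `ρ̄₊ - ρ̄₋` into `ρ̄ u`.

For `ψ = z` only switching remains and its factor `1/N` cancels `N`. Fubini replaces `γ_j` by the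
effective rate (`integral_rate_mul`), and concentration at `ρ̄` allows passing to the limit in the
rate, which varies together with the law (`gridTendsto_switching`).

The last assertion holds because limits on the grid are automatically continuous and periodic in
space, so the monokinetic laws placed on the grid converge to `f` as well. -/

theorem hydroFilter_eventually {x t : ℝ} {P : ℕ+ × ℤ × ℝ → Prop}
    (h : ∀ᶠ q in hydroFilter x t, P q) :
    ∃ N₀ : ℕ+, ∃ δ > 0, ∀ (N : ℕ+) (j : ℤ) (s : ℝ), N₀ ≤ N → |(j : ℝ) / (N : ℝ) - x| < δ →
      |s - t| < δ → P (N, j, s) := by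
  rw [hydroFilter, eventually_comap] at h
  have hb := (atTop_basis (α := ℕ+)).prod ((Metric.nhds_basis_ball (x := x)).prod
    (Metric.nhds_basis_ball (x := t)))
  obtain ⟨⟨N₀, δ₁, δ₂⟩, ⟨-, h₁, h₂⟩, hsub⟩ := hb.eventually_iff.1 h
  refine ⟨N₀, min δ₁ δ₂, lt_min h₁ h₂, fun N j s hN hj hs => ?_⟩
  refine hsub (x := (N, (j : ℝ) / (N : ℝ), s)) ?_ (N, j, s) rfl
  refine ⟨hN, ?_, ?_⟩
  · simpa [Real.dist_eq] using hj.trans_le (min_le_left _ _)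
  · simpa [Real.dist_eq] using hs.trans_le (min_le_right _ _)

theorem tendsto_hydroFilter {ι : Type*} {l : Filter ι} {x t : ℝ} {q : ι → ℕ+ × ℤ × ℝ}
    (hN : Tendsto (fun i => (q i).1) l atTop)
    (hx : Tendsto (fun i => ((q i).2.1 : ℝ) / ((q i).1 : ℝ)) l (𝓝 x))
    (ht : Tendsto (fun i => (q i).2.2) l (𝓝 t)) : Tendsto q l (hydroFilter x t) :=
  tendsto_comap_iff.2 (hN.prodMk (hx.prodMk ht))

theorem hydroFilter_tendsto_fst (x t : ℝ) :
    Tendsto (fun q : ℕ+ × ℤ × ℝ => q.1) (hydroFilter x t) atTop :=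
  tendsto_fst.comp (f := fun q : ℕ+ × ℤ × ℝ => (q.1, (q.2.1 : ℝ) / (q.1 : ℝ), q.2.2))
    tendsto_comap

theorem hydroFilter_tendsto_pos (x t : ℝ) :
    Tendsto (fun q : ℕ+ × ℤ × ℝ => (q.2.1 : ℝ) / (q.1 : ℝ)) (hydroFilter x t) (𝓝 x) :=
  (tendsto_fst.comp tendsto_snd).comp
    (f := fun q : ℕ+ × ℤ × ℝ => (q.1, (q.2.1 : ℝ) / (q.1 : ℝ), q.2.2)) tendsto_comap

theorem hydroFilter_tendsto_time (x t : ℝ) :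
    Tendsto (fun q : ℕ+ × ℤ × ℝ => q.2.2) (hydroFilter x t) (𝓝 t) :=
  (tendsto_snd.comp tendsto_snd).comp
    (f := fun q : ℕ+ × ℤ × ℝ => (q.1, (q.2.1 : ℝ) / (q.1 : ℝ), q.2.2)) tendsto_comap

theorem tendsto_pnat_cast : Tendsto (fun N : ℕ+ => (N : ℝ)) atTop atTop :=
  tendsto_natCast_atTop_atTop.comp tendsto_PNat_val_atTop_atTop

theorem tendsto_floor_div (x : ℝ) :
    Tendsto (fun N : ℕ+ => ((⌊x * (N : ℝ)⌋ : ℤ) : ℝ) / (N : ℝ)) atTop (𝓝 x) := by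
  have hpos : ∀ N : ℕ+, (0 : ℝ) < (N : ℝ) := fun N => by exact_mod_cast N.pos
  have h0 : Tendsto (fun N : ℕ+ => x - 1 / (N : ℝ)) atTop (𝓝 x) := by
    simpa using (tendsto_pnat_cast.const_div_atTop 1).const_sub x
  refine tendsto_of_tendsto_of_tendsto_of_le_of_le h0 tendsto_const_nhds (fun N => ?_)
    (fun N => (div_le_iff₀ (hpos N)).2 (Int.floor_le _))
  rw [le_div_iff₀ (hpos N), sub_mul, one_div, inv_mul_cancel₀ (hpos N).ne']
  exact (Int.sub_one_lt_floor _).le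

/-- Grid points left of `x` and nearest to it, at varying times. -/
theorem tendsto_floor_hydroFilter {ι : Type*} {l : Filter ι} {N : ι → ℕ+} {s : ι → ℝ} (x : ℝ)
    {t : ℝ} (hN : Tendsto N l atTop) (hs : Tendsto s l (𝓝 t)) :
    Tendsto (fun i => (N i, ⌊x * (N i : ℝ)⌋, s i)) l (hydroFilter x t) :=
  tendsto_hydroFilter hN ((tendsto_floor_div x).comp hN) hs

instance hydroFilter_neBot (x t : ℝ) : (hydroFilter x t).NeBot :=
  (tendsto_floor_hydroFilter x (tendsto_id (α := ℕ+) (x := atTop))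
    (tendsto_const_nhds (x := t))).neBot

theorem hydroFilter_tendsto_add (x t : ℝ) (m : ℤ) :
    Tendsto (fun q : ℕ+ × ℤ × ℝ => (q.1, q.2.1 + m, q.2.2)) (hydroFilter x t)
      (hydroFilter x t) := by
  refine tendsto_hydroFilter (hydroFilter_tendsto_fst x t) ?_ (hydroFilter_tendsto_time x t)
  have h := (hydroFilter_tendsto_pos x t).add
    ((tendsto_pnat_cast.comp (hydroFilter_tendsto_fst x t)).const_div_atTop (m : ℝ))
  simpa [add_div] using h

/-- A shift by `N` cells is invisible in `ZMod N` but moves the point by one period; this is the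
source of the periodicity of all limits. -/
theorem hydroFilter_tendsto_period (x t : ℝ) :
    Tendsto (fun q : ℕ+ × ℤ × ℝ => (q.1, q.2.1 + (q.1 : ℕ), q.2.2)) (hydroFilter x t)
      (hydroFilter (x + 1) t) := by
  refine tendsto_hydroFilter (hydroFilter_tendsto_fst x t) ?_ (hydroFilter_tendsto_time x t)
  refine ((hydroFilter_tendsto_pos x t).add_const 1).congr fun q => ?_
  have : ((q.1 : ℕ) : ℝ) ≠ 0 := by simp
  push_cast
  field_simp

section GridTendsto

variable {a : (N : ℕ+) → ZMod N → ℝ → ℝ} {b : ℝ → ℝ → ℝ}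

theorem GridTendsto.comp_shift (h : GridTendsto a b) (m : ℤ) :
    GridTendsto (fun N j t => a N (j + m) t) b := by
  intro x t ht
  refine ((h x t ht).comp (hydroFilter_tendsto_add x t m)).congr fun q => ?_
  simp

theorem GridTendsto.periodic (h : GridTendsto a b) {t : ℝ} (ht : 0 < t) :
    Function.Periodic (fun x => b x t) 1 := by
  intro x
  refine tendsto_nhds_unique
    (((h (x + 1) t ht).comp (hydroFilter_tendsto_period x t)).congr fun q => ?_) (h x t ht)
  simp

theorem GridTendsto.tendsto_floor (h : GridTendsto a b) (x : ℝ) {t : ℝ} (ht : 0 < t) :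
    Tendsto (fun N : ℕ+ => a N (⌊x * (N : ℝ)⌋ : ℤ) t) atTop (𝓝 (b x t)) :=
  (h x t ht).comp (tendsto_floor_hydroFilter x tendsto_id tendsto_const_nhds)

/-- The value of `b` at a nearby point is the limit of grid values along floor points. These
eventually lie in the neighbourhood of `(x, t)` where grid values are `ε / 2`-close to `b x t`. No
continuity of `a` is needed. -/
theorem GridTendsto.continuousAt (h : GridTendsto a b) (x : ℝ) {t : ℝ} (ht : 0 < t) :
    ContinuousAt (fun p : ℝ × ℝ => b p.1 p.2) (x, t) := by
  refine Metric.continuousAt_iff'.2 fun ε hε => ?_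
  obtain ⟨N₀, δ, hδ, hN⟩ := hydroFilter_eventually
    ((Metric.tendsto_nhds.1 (h x t ht)) (ε / 2) (half_pos hε))
  have hx : ∀ᶠ p : ℝ × ℝ in 𝓝 (x, t), |p.1 - x| < δ :=
    (continuous_fst.tendsto (x, t)).eventually (Metric.ball_mem_nhds x hδ)
  have hs : ∀ᶠ p : ℝ × ℝ in 𝓝 (x, t), |p.2 - t| < δ :=
    (continuous_snd.tendsto (x, t)).eventually (Metric.ball_mem_nhds t hδ)
  have hpos : ∀ᶠ p : ℝ × ℝ in 𝓝 (x, t), 0 < p.2 :=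
    (continuous_snd.tendsto (x, t)).eventually (lt_mem_nhds ht)
  filter_upwards [hx, hs, hpos] with p hpx hps hp
  refine lt_of_le_of_lt ?_ (half_lt_self hε)
  refine le_of_tendsto ((h.tendsto_floor p.1 hp).dist tendsto_const_nhds) ?_
  have hfl : ∀ᶠ N : ℕ+ in atTop, |((⌊p.1 * (N : ℝ)⌋ : ℤ) : ℝ) / (N : ℝ) - x| < δ :=
    ((tendsto_floor_div p.1).sub_const x).abs.eventually (gt_mem_nhds hpx)
  filter_upwards [hfl, eventually_ge_atTop N₀] with N hfN hNN
  exact (hN N _ p.2 hNN hfN hps).le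

/-- If functions on the grid and their time derivatives converge, then the limit of the
derivatives is the time derivative of the limit. -/
theorem GridTendsto.hasDerivAt_time {a' : (N : ℕ+) → ZMod N → ℝ → ℝ} {c : ℝ → ℝ → ℝ}
    (h : GridTendsto a b) (h' : GridTendsto a' c)
    (hd : ∀ N j t, 0 < t → HasDerivAt (a N j) (a' N j t) t) (x : ℝ) {t : ℝ} (ht : 0 < t) :
    HasDerivAt (b x) (c x t) t := by
  refine hasDerivAt_of_tendstoLocallyUniformlyOn (l := atTop) (s := Set.Ioi (0 : ℝ))
    (f := fun (N : ℕ+) => a N (⌊x * (N : ℝ)⌋ : ℤ)) (f' := fun N => a' N (⌊x * (N : ℝ)⌋ : ℤ))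
    isOpen_Ioi ?_ (Eventually.of_forall fun N s hs => hd N _ s hs)
    (fun s hs => h.tendsto_floor x hs) ht
  rw [tendstoLocallyUniformlyOn_iff_filter]
  intro s hs
  rw [tendstoUniformlyOnFilter_iff_tendsto]
  -- Uniform closeness near `s` follows because the limit `c x` (by its continuity) and the grid
  -- derivatives both tend to the same number `c x s`.
  refine Tendsto.mono_right ?_ (nhds_le_uniformity (c x s))
  rw [nhds_prod_eq]
  have hsnd : Tendsto (fun p : ℕ+ × ℝ => p.2) (atTop ×ˢ 𝓝[Set.Ioi 0] s) (𝓝 s) :=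
    tendsto_snd.mono_right nhdsWithin_le_nhds
  refine Tendsto.prodMk ?_ ?_
  · exact (h'.continuousAt x hs).tendsto.comp
      ((tendsto_const_nhds (x := x)).prodMk_nhds hsnd)
  · exact (h' x s hs).comp (tendsto_floor_hydroFilter x tendsto_fst hsnd)

/-- If functions on the grid and their difference quotients converge, then the limit of the
difference quotients is the space derivative of the limit. -/
theorem GridTendsto.hasDerivAt_space {D : ℝ → ℝ → ℝ} (h : GridTendsto a b)
    (h' : GridTendsto (fun N j t => (a N (j + 1) t - a N j t) / (1 / (N : ℝ))) D) (x : ℝ)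
    {t : ℝ} (ht : 0 < t) : HasDerivAt (fun y => b y t) (D x t) x := by
  rw [hasDerivAt_iff_isLittleO, Asymptotics.isLittleO_iff]
  intro ε hε
  obtain ⟨N₀, δ, hδ, hN⟩ := hydroFilter_eventually ((Metric.tendsto_nhds.1 (h' x t ht)) ε hε)
  -- Telescoping: each one-cell increment is `D x t / N` up to `ε / N`. Intermediate cells lie
  -- between the two end cells, hence also within `δ` of `x`.
  have grid : ∀ N : ℕ+, N₀ ≤ N → ∀ j : ℤ, ∀ n : ℕ, |(j : ℝ) / (N : ℝ) - x| < δ →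
      |((j + n : ℤ) : ℝ) / (N : ℝ) - x| < δ →
      |a N ((j + n : ℤ) : ZMod N) t - a N (j : ZMod N) t - D x t * (n / (N : ℝ))|
        ≤ ε * (n / (N : ℝ)) := by
    intro N hNN j n hj
    have hNpos : (0 : ℝ) < (N : ℝ) := by exact_mod_cast N.pos
    induction n with
    | zero => intro _; simp
    | succ n ih =>
      intro hn
      have hmid : |((j + n : ℤ) : ℝ) / (N : ℝ) - x| < δ := by
        rw [abs_lt] at hj hn ⊢
        have h1 : (j : ℝ) / N ≤ ((j + n : ℤ) : ℝ) / N := by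
          gcongr; linarith [Int.natCast_nonneg n]
        have h2 : ((j + n : ℤ) : ℝ) / N ≤ ((j + (n + 1 : ℕ) : ℤ) : ℝ) / N := by
          gcongr; linarith
        constructor <;> linarith
      have step := (hN N (j + n) t hNN hmid (by simpa using hδ)).le
      have ih := ih hmid
      rw [Real.dist_eq] at step
      have hcast : (((j + n : ℤ) : ZMod N) + 1) = ((j + (n + 1 : ℕ) : ℤ) : ZMod N) := by
        push_cast; ring
      simp only [hcast] at step
      set A := a N ((j + (n + 1 : ℕ) : ℤ) : ZMod N) t
      set B := a N ((j + n : ℤ) : ZMod N) t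
      have e1 : |A - B - D x t * (1 / N)| ≤ ε * (1 / N) := by
        have : A - B - D x t * (1 / N) = ((A - B) / (1 / (N : ℝ)) - D x t) * (1 / N) := by
          field_simp
        rw [this, abs_mul, abs_of_pos (a := 1 / (N : ℝ)) (by positivity)]
        gcongr
      have e2 := abs_add_le (A - B - D x t * (1 / N))
        (B - a N (j : ZMod N) t - D x t * (n / (N : ℝ)))
      have e3 : A - a N (j : ZMod N) t - D x t * ((n + 1 : ℕ) / (N : ℝ))
          = (A - B - D x t * (1 / N)) + (B - a N (j : ZMod N) t - D x t * (n / (N : ℝ))) := by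
        push_cast; ring
      have e4 : ε * ((n + 1 : ℕ) / (N : ℝ)) = ε * (1 / N) + ε * (n / (N : ℝ)) := by
        push_cast; ring
      rw [e3, e4]
      linarith
  -- The grid estimate for the floor points of `y` and `y'` passes to the limit; its error is
  -- already proportional to the distance.
  have lim : ∀ y y' : ℝ, |y - x| < δ → |y' - x| < δ → y ≤ y' →
      |b y' t - b y t - D x t * (y' - y)| ≤ ε * (y' - y) := by
    intro y y' hy hy' hyy
    have T := ((h.tendsto_floor y' ht).sub (h.tendsto_floor y ht)).sub
      (((tendsto_floor_div y').sub (tendsto_floor_div y)).const_mul (D x t))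
    have T' := ((tendsto_floor_div y').sub (tendsto_floor_div y)).const_mul ε
    refine le_of_tendsto_of_tendsto T.abs T' ?_
    have h1 : ∀ᶠ N : ℕ+ in atTop, |((⌊y * (N : ℝ)⌋ : ℤ) : ℝ) / (N : ℝ) - x| < δ :=
      ((tendsto_floor_div y).sub_const x).abs.eventually (gt_mem_nhds hy)
    have h2 : ∀ᶠ N : ℕ+ in atTop, |((⌊y' * (N : ℝ)⌋ : ℤ) : ℝ) / (N : ℝ) - x| < δ :=
      ((tendsto_floor_div y').sub_const x).abs.eventually (gt_mem_nhds hy')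
    filter_upwards [h1, h2, eventually_ge_atTop N₀] with N h1 h2 hNN
    have hle : ⌊y * (N : ℝ)⌋ ≤ ⌊y' * (N : ℝ)⌋ := Int.floor_le_floor (by gcongr)
    obtain ⟨n, hn⟩ := Int.eq_ofNat_of_zero_le (sub_nonneg.2 hle)
    have hk : ⌊y' * (N : ℝ)⌋ = ⌊y * (N : ℝ)⌋ + n := by omega
    have hdiff : ((⌊y' * (N : ℝ)⌋ : ℤ) : ℝ) / (N : ℝ) - ((⌊y * (N : ℝ)⌋ : ℤ) : ℝ) / (N : ℝ)
        = n / (N : ℝ) := by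
      rw [hk]; push_cast; ring
    have := grid N hNN _ n h1 (hk ▸ h2)
    rw [← hk] at this
    rw [hdiff]
    exact this
  have hx : ∀ᶠ y in 𝓝 x, |y - x| < δ := Metric.ball_mem_nhds x hδ
  filter_upwards [hx] with y hy
  simp only [smul_eq_mul, Real.norm_eq_abs]
  have h0 : |x - x| < δ := by simpa using hδ
  rcases le_total x y with hxy | hxy
  · rw [abs_of_nonneg (sub_nonneg.2 hxy), mul_comm (y - x)]
    exact lim x y h0 hy hxy
  · rw [abs_of_nonpos (sub_nonpos.2 hxy), neg_sub, abs_sub_comm]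
    convert lim y x hy h0 hxy using 2
    ring

/-- If the time derivatives, divided by the number of cells, converge, then they converge to
zero: on time intervals of length `1 / √N` the values have bounded oscillation. -/
theorem GridTendsto.tendsto_deriv_div_eq_zero {c : ℝ → ℝ → ℝ}
    {a' : (N : ℕ+) → ZMod N → ℝ → ℝ} (h : GridTendsto a b) (h' : GridTendsto a' c)
    (hd : ∀ᶠ N : ℕ+ in atTop, ∀ j t, 0 < t → HasDerivAt (a N j) ((N : ℝ) * a' N j t) t) (x : ℝ)
    {t : ℝ} (ht : 0 < t) : c x t = 0 := by
  -- The length tends to zero, so the intermediate times tend to `t`. Since `N η² = 1`, the mean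
  -- value theorem reads `a' = η ·` increment of `a`.
  set η : ℕ+ → ℝ := fun N => 1 / √(N : ℝ) with hη
  have hsq : Tendsto (fun N : ℕ+ => √(N : ℝ)) atTop atTop :=
    Real.tendsto_sqrt_atTop.comp tendsto_pnat_cast
  have hη0 : Tendsto η atTop (𝓝 0) := hsq.const_div_atTop 1
  have hηpos : ∀ N, 0 < η N := fun N => by
    have : (0 : ℝ) < (N : ℝ) := by exact_mod_cast N.pos
    simp only [hη]; positivity
  have hmv : ∀ᶠ N : ℕ+ in atTop, ∃ s ∈ Set.Ioo t (t + η N),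
      (N : ℝ) * a' N (⌊x * (N : ℝ)⌋ : ℤ) s = (a N (⌊x * (N : ℝ)⌋ : ℤ) (t + η N)
        - a N (⌊x * (N : ℝ)⌋ : ℤ) t) / (t + η N - t) := by
    filter_upwards [hd] with N hN
    exact exists_hasDerivAt_eq_slope _ _ (by linarith [hηpos N])
      (fun s hs => (hN _ s (ht.trans_le hs.1)).continuousAt.continuousWithinAt)
      (fun s hs => hN _ s (ht.trans hs.1))
  obtain ⟨s, hs⟩ := hmv.choice
  have hadd : Tendsto (fun N => t + η N) atTop (𝓝 t) := by simpa using hη0.const_add t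
  have hst : Tendsto s atTop (𝓝 t) := by
    refine tendsto_of_tendsto_of_tendsto_of_le_of_le' tendsto_const_nhds hadd ?_ ?_
    · filter_upwards [hs] with N hN using hN.1.1.le
    · filter_upwards [hs] with N hN using hN.1.2.le
  have T1 : Tendsto (fun N : ℕ+ => a' N (⌊x * (N : ℝ)⌋ : ℤ) (s N)) atTop (𝓝 (c x t)) :=
    (h' x t ht).comp (tendsto_floor_hydroFilter x tendsto_id hst)
  have T2 : Tendsto (fun N : ℕ+ => a N (⌊x * (N : ℝ)⌋ : ℤ) (t + η N)) atTop (𝓝 (b x t)) :=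
    (h x t ht).comp (tendsto_floor_hydroFilter x tendsto_id hadd)
  have T3 := (T2.sub (h.tendsto_floor x ht)).mul hη0
  rw [mul_zero] at T3
  refine tendsto_nhds_unique (T1.congr' ?_) T3
  filter_upwards [hs] with N hN
  have hNpos : (0 : ℝ) < (N : ℝ) := by exact_mod_cast N.pos
  have e := hN.2
  rw [add_sub_cancel_left, eq_div_iff (hηpos N).ne'] at e
  rw [← e]
  have : (N : ℝ) * (η N * η N) = 1 := by
    simp only [hη]
    rw [div_mul_div_comm, Real.mul_self_sqrt hNpos.le]
    field_simp
  linear_combination (-a' N (⌊x * (N : ℝ)⌋ : ℤ) (s N)) * this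

end GridTendsto

/-! ### Laws of one cell -/

instance measurableSingletonClass_intUnits : MeasurableSingletonClass ℤˣ where
  measurableSet_singleton z := by
    refine ⟨{(z : ℤ)}, measurableSet_singleton _, ?_⟩
    ext w
    simp [Units.ext_iff]

theorem measurable_cell {β : Type*} [MeasurableSpace β] {φ : ℤˣ → ℝ≥0 → β}
    (h : ∀ z, Measurable (φ z)) : Measurable fun a : Cell => φ a.1 a.2 :=
  measurable_from_prod_countable_right h

theorem measurable_dens : Measurable dens :=
  measurable_cell (φ := fun _ ρ => (ρ : ℝ)) fun _ => measurable_coe_nnreal_real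

theorem measurable_dir : Measurable dir :=
  measurable_cell (φ := fun z _ => ((z : ℤ) : ℝ)) fun _ => measurable_const

theorem dens_nonneg (a : Cell) : 0 ≤ dens a := a.2.2

theorem abs_dir (a : Cell) : |dir a| = 1 := by
  rcases Int.units_eq_one_or a.1 with h | h <;> simp [dir, h]

/-- The density of a cell with direction `z`, and zero for the other direction. -/
def densOf (z : ℤˣ) (a : Cell) : ℝ := if a.1 = z then dens a else 0

theorem measurable_densOf (z : ℤˣ) : Measurable (densOf z) :=
  measurable_cell (φ := fun w ρ => if w = z then (ρ : ℝ) else 0) fun w => by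
    by_cases h : w = z
    · simpa [h] using measurable_coe_nnreal_real
    · simp [h]

theorem abs_densOf_le (z : ℤˣ) (a : Cell) : |densOf z a| ≤ dens a := by
  unfold densOf
  split_ifs
  · rw [abs_of_nonneg (dens_nonneg a)]
  · simpa using dens_nonneg a

theorem measurableSet_fst (z : ℤˣ) : MeasurableSet (Prod.fst ⁻¹' {z} : Set Cell) :=
  measurable_fst (measurableSet_singleton z)

theorem prob_eq_measureReal (μ : Measure Cell) (z : ℤˣ) :
    prob μ z = μ.real (Prod.fst ⁻¹' {z}) := by
  rw [prob, component, measureReal_def, Measure.map_apply measurable_snd MeasurableSet.univ]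
  simp [measureReal_def]

theorem indicator_fst_eq_ite (z : ℤˣ) (φ : Cell → ℝ) :
    (Prod.fst ⁻¹' {z} : Set Cell).indicator φ = fun a => if a.1 = z then φ a else 0 := by
  funext a
  by_cases h : a.1 = z <;> simp [h]

theorem prob_eq_integral (μ : Measure Cell) (z : ℤˣ) :
    prob μ z = ∫ a, (if a.1 = z then 1 else 0 : ℝ) ∂μ := by
  rw [prob_eq_measureReal, ← integral_indicator_one (measurableSet_fst z),
    indicator_fst_eq_ite]
  rfl

theorem meanDensOf_eq_integral (μ : Measure Cell) (z : ℤˣ) :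
    meanDensOf μ z = ∫ a, densOf z a ∂μ := by
  rw [meanDensOf, component, integral_map measurable_snd.aemeasurable
    measurable_coe_nnreal_real.aestronglyMeasurable, ← integral_indicator (measurableSet_fst z),
    indicator_fst_eq_ite]
  rfl

theorem integrable_ite_fst (μ : Measure Cell) [IsFiniteMeasure μ] (z : ℤˣ) :
    Integrable (fun a : Cell => (if a.1 = z then 1 else 0 : ℝ)) μ := by
  rw [← indicator_fst_eq_ite z fun _ => 1]
  exact (integrable_indicator_iff (measurableSet_fst z)).2 (integrable_const 1).integrableOn

theorem prob_nonneg (μ : Measure Cell) (z : ℤˣ) : 0 ≤ prob μ z := measureReal_nonneg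

theorem integrable_of_linear_growth {μ : Measure Cell} (hμ : Integrable (fun a => 1 + dens a) μ)
    {φ : ℤˣ → ℝ≥0 → ℝ} (hφ : ∀ z, Measurable (φ z)) {C : ℝ}
    (hC : ∀ z (ρ : ℝ≥0), |φ z ρ| ≤ C * (1 + (ρ : ℝ))) :
    Integrable (fun a : Cell => φ a.1 a.2) μ :=
  (hμ.const_mul C).mono' (measurable_cell hφ).aestronglyMeasurable
    (Eventually.of_forall fun a => hC a.1 a.2)

theorem isFiniteMeasure_of_integrable {μ : Measure Cell}
    (hμ : Integrable (fun a => 1 + dens a) μ) : IsFiniteMeasure μ := by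
  have h : Integrable (fun _ : Cell => (1 : ℝ)) μ :=
    hμ.mono' aestronglyMeasurable_const (Eventually.of_forall fun a => by
      simpa using dens_nonneg a)
  simpa using (integrable_const_iff).1 h

theorem integrable_densOf {μ : Measure Cell} (hμ : Integrable dens μ) (z : ℤˣ) :
    Integrable (densOf z) μ :=
  hμ.mono' (measurable_densOf z).aestronglyMeasurable (Eventually.of_forall (abs_densOf_le z))

theorem densOf_add (a : Cell) : densOf 1 a + densOf (-1) a = dens a := by
  rcases Int.units_eq_one_or a.1 with h | h <;> simp [densOf, h]

theorem meanDens_eq_integral {μ : Measure Cell} (hμ : Integrable dens μ) :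
    meanDens μ = ∫ a, dens a ∂μ := by
  rw [meanDens, meanDensOf_eq_integral, meanDensOf_eq_integral,
    ← integral_add (integrable_densOf hμ 1) (integrable_densOf hμ (-1))]
  simp only [densOf_add]

theorem meanDens_nonneg {μ : Measure Cell} (hμ : Integrable dens μ) : 0 ≤ meanDens μ := by
  rw [meanDens_eq_integral hμ]
  exact integral_nonneg dens_nonneg

theorem velocity_eq_integral (μ : Measure Cell) [IsFiniteMeasure μ] :
    velocity μ = ∫ a, dir a ∂μ := by
  rw [velocity, prob_eq_integral, prob_eq_integral,
    ← integral_sub (integrable_ite_fst μ 1) (integrable_ite_fst μ (-1))]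
  refine integral_congr_ae (Eventually.of_forall fun a => ?_)
  rcases Int.units_eq_one_or a.1 with h | h <;> simp [dir, h]

theorem sum_prob (μ : Measure Cell) [IsProbabilityMeasure μ] : prob μ 1 + prob μ (-1) = 1 := by
  have hc : (Prod.fst ⁻¹' {(-1 : ℤˣ)} : Set Cell) = (Prod.fst ⁻¹' {(1 : ℤˣ)})ᶜ := by
    ext a
    rcases Int.units_eq_one_or a.1 with h | h <;> simp [h]
  rw [prob_eq_measureReal, prob_eq_measureReal, hc, probReal_add_probReal_compl]
  exact measurableSet_fst 1

theorem sum_intUnits {β : Type*} [AddCommMonoid β] (φ : ℤˣ → β) :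
    ∑ z : ℤˣ, φ z = φ 1 + φ (-1) :=
  Finset.sum_pair (by decide)

/-! ### Laws concentrated on one density -/

theorem component_eq_dirac {μ : Measure Cell} [IsFiniteMeasure μ] {c : ℝ≥0}
    (h : ∀ᵐ a ∂μ, a.2 = c) (z : ℤˣ) :
    component μ z = ENNReal.ofReal (prob μ z) • Measure.dirac c := by
  have h1 : component μ z = (μ.restrict (Prod.fst ⁻¹' {z})).map (fun _ => c) :=
    Measure.map_congr (ae_restrict_of_ae h)
  rw [h1, Measure.map_const, prob_eq_measureReal, ofReal_measureReal]
  simp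

/-- No regularity of `φ` is needed, since almost everywhere it is only evaluated at density `c`. -/
theorem integral_eq_sum_prob {μ : Measure Cell} [IsFiniteMeasure μ] {c : ℝ≥0}
    (h : ∀ᵐ a ∂μ, a.2 = c) (φ : ℤˣ → ℝ≥0 → ℝ) :
    ∫ a, φ a.1 a.2 ∂μ = ∑ z, prob μ z * φ z c := by
  have h1 : (fun a : Cell => φ a.1 a.2) =ᵐ[μ]
      fun a => ∑ z, (if a.1 = z then 1 else 0 : ℝ) * φ z c := by
    filter_upwards [h] with a ha
    simp only [ha, ite_mul, one_mul, zero_mul, Finset.sum_ite_eq, Finset.mem_univ, if_true]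
  rw [integral_congr_ae h1, integral_finsetSum _ fun z _ => (integrable_ite_fst μ z).mul_const _]
  simp only [integral_mul_const, prob_eq_integral]

/-! ### Product laws -/

section Product

variable {N : ℕ}

theorem measurable_update_cell (j : ZMod N) :
    Measurable (fun p : Config N × Cell => Function.update p.1 j p.2) := by
  refine measurable_pi_iff.2 fun i => ?_
  by_cases h : i = j
  · subst h; simpa using measurable_snd
  · simp only [Function.update_of_ne h]
    exact (measurable_pi_apply (X := fun _ : ZMod N => Cell) i).comp measurable_fst

variable [NeZero N]

/-- Resampling coordinate `j` independently from its own law does not change a product law; boxes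
suffice to check it. It expresses the overwriting in `effRate` as a Fubini integration. -/
theorem map_update_pi (g : ZMod N → Measure Cell) [∀ i, IsProbabilityMeasure (g i)]
    (j : ZMod N) :
    ((Measure.pi g).prod (g j)).map (fun p => Function.update p.1 j p.2) = Measure.pi g := by
  symm
  refine Measure.pi_eq fun B hB => ?_
  rw [Measure.map_apply (measurable_update_cell j) (MeasurableSet.univ_pi hB)]
  have hpre : (fun p : Config N × Cell => Function.update p.1 j p.2) ⁻¹' (Set.univ.pi B)
      = (Set.univ.pi (Function.update B j Set.univ)) ×ˢ B j := by
    ext p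
    simp only [Set.mem_preimage, Set.mem_univ_pi, Set.mem_prod]
    constructor
    · intro h
      refine ⟨fun i => ?_, by simpa using h j⟩
      by_cases hi : i = j
      · subst hi; simp
      · simpa [hi] using h i
    · rintro ⟨h, hj⟩ i
      by_cases hi : i = j
      · subst hi; simpa using hj
      · simpa [hi] using h i
  rw [hpre, Measure.prod_prod, Measure.pi_pi, ← Finset.prod_erase_mul _ _ (Finset.mem_univ j),
    ← Finset.prod_erase_mul (f := fun i => g i (B i)) _ (Finset.mem_univ j)]
  simp only [Function.update_self, measure_univ, mul_one]
  congr 1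
  refine Finset.prod_congr rfl fun i hi => ?_
  rw [Function.update_of_ne (Finset.ne_of_mem_erase hi)]

theorem measurable_effRate {γ : ZMod N → Config N → ℝ} (hγ : ∀ j, Measurable (γ j))
    (g : ZMod N → Measure Cell) [∀ i, IsProbabilityMeasure (g i)] (j : ZMod N) :
    Measurable fun a : Cell => effRate γ g j a.1 a.2 := by
  have h : StronglyMeasurable fun p : Config N × Cell => γ j (Function.update p.1 j p.2) :=
    ((hγ j).comp (measurable_update_cell j)).stronglyMeasurable
  exact (h.integral_prod_left' (μ := Measure.pi g)).measurable

theorem effRate_nonneg {γ : ZMod N → Config N → ℝ} (hγ : ∀ j s, 0 ≤ γ j s)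
    (g : ZMod N → Measure Cell) (j : ZMod N) (z : ℤˣ) (ρ : ℝ≥0) : 0 ≤ effRate γ g j z ρ :=
  integral_nonneg fun _ => hγ _ _

/-- Integrating out all the cells but `j` replaces the rate by the effective rate. -/
theorem integral_rate_mul {γ : ZMod N → Config N → ℝ} (g : ZMod N → Measure Cell)
    [∀ i, IsProbabilityMeasure (g i)] (j : ZMod N) {κ : Cell → ℝ}
    (hintg : Integrable (fun s => γ j s * κ (s j)) (Measure.pi g)) :
    ∫ s, γ j s * κ (s j) ∂(Measure.pi g) = ∫ a, effRate γ g j a.1 a.2 * κ a ∂(g j) := by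
  have hm := measurable_update_cell (N := N) j
  rw [← map_update_pi g j] at hintg
  have hintg' := hintg.comp_measurable hm
  conv_lhs => rw [← map_update_pi g j]
  rw [integral_map hm.aemeasurable hintg.aestronglyMeasurable]
  refine (integral_prod_symm _ hintg').trans ?_
  refine integral_congr_ae (Eventually.of_forall fun a => ?_)
  simp [effRate, integral_mul_const]

theorem integral_pi_mul_of_ne (g : ZMod N → Measure Cell) [∀ i, IsProbabilityMeasure (g i)]
    {i j : ZMod N} (hij : i ≠ j) {φ ψ : Cell → ℝ} (hφ : Measurable φ) (hψ : Measurable ψ) :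
    ∫ s, φ (s i) * ψ (s j) ∂(Measure.pi g) = (∫ a, φ a ∂(g i)) * ∫ a, ψ a ∂(g j) := by
  have hind := (ProbabilityTheory.iIndepFun_pi (μ := g) (X := fun _ a => a)
    fun i => measurable_id.aemeasurable).indepFun hij
  have h := (hind.comp hφ hψ).integral_fun_mul_eq_mul_integral
    (hφ.comp (measurable_pi_apply i)).aestronglyMeasurable
    (hψ.comp (measurable_pi_apply j)).aestronglyMeasurable
  have e : ∀ (k : ZMod N) {χ : Cell → ℝ}, Measurable χ →
      ∫ s, χ (s k) ∂(Measure.pi g) = ∫ a, χ a ∂(g k) := fun k χ hχ => by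
    have := (measurePreserving_eval g k)
    rw [← this.map_eq, integral_map (measurable_pi_apply k).aemeasurable
      hχ.aestronglyMeasurable]
  rw [← e i hφ, ← e j hψ]
  exact h

end Product

/-! ### Evolution of the one-cell marginals -/

section Marginals

variable {N : ℕ}

theorem integral_marginal (μ : Measure (Config N)) (j : ZMod N) {φ : Cell → ℝ}
    (hφ : Measurable φ) : ∫ a, φ a ∂(marginal μ j) = ∫ s, φ (s j) ∂μ :=
  integral_map (measurable_pi_apply j).aemeasurable hφ.aestronglyMeasurable

theorem integrable_marginal_iff (μ : Measure (Config N)) (j : ZMod N) {φ : Cell → ℝ}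
    (hφ : Measurable φ) : Integrable φ (marginal μ j) ↔ Integrable (fun s => φ (s j)) μ :=
  integrable_map_measure hφ.aestronglyMeasurable (measurable_pi_apply j).aemeasurable

instance isProbabilityMeasure_marginal (μ : Measure (Config N)) [IsProbabilityMeasure μ]
    (j : ZMod N) : IsProbabilityMeasure (marginal μ j) :=
  Measure.isProbabilityMeasure_map (measurable_pi_apply j).aemeasurable

/-- Whatever its direction, a cell loses its whole density at unit rate; it gains from the left
neighbour if that points right and from the right neighbour if that points left. -/
theorem flux_sub_flux (s : Config N) (j : ZMod N) :
    flux s j - flux s (j - 1)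
      = dens (s j) - (densOf 1 (s (j - 1)) + densOf (-1) (s (j + 1))) := by
  have hpos : ∀ a : Cell, dens a * max (dir a) 0 = densOf 1 a := fun a => by
    rcases Int.units_eq_one_or a.1 with h | h <;> simp [densOf, dir, h]
  have hneg : ∀ a : Cell, dens a * min (dir a) 0 = -densOf (-1) a := fun a => by
    rcases Int.units_eq_one_or a.1 with h | h <;> simp [densOf, dir, h]
  simp only [flux, hpos, hneg, sub_add_cancel]
  linear_combination densOf_add (s j)

variable [NeZero N]

theorem generator_oneCell (γ : ZMod N → Config N → ℝ) (j : ZMod N) (ψ : ℤˣ → ℝ → ℝ)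
    (s : Config N) :
    generator γ (oneCell j ψ) s
      = -((dens (s j) - (densOf 1 (s (j - 1)) + densOf (-1) (s (j + 1))))
          * deriv (ψ (s j).1) (dens (s j)))
        + (1 / (N : ℝ)) * (γ j s * (ψ (-(s j).1) (dens (s j)) - ψ (s j).1 (dens (s j)))) := by
  rw [generator, Finset.sum_eq_single j, Finset.sum_eq_single j, flux_sub_flux]
  · simp [partialDens, oneCell, evalAt, switch, dens]
  · intro i _ hij
    simp [evalAt, oneCell, switch, Function.update_of_ne hij.symm]
  · simp
  · intro i _ hij
    simp [partialDens, oneCell, Function.update_of_ne hij.symm]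
  · simp

variable {γ : ZMod N → Config N → ℝ} {F : ℝ → Measure (Config N)}

theorem SolvesMasterEquation.integrable_marginal (hF : SolvesMasterEquation γ F) {t : ℝ}
    (ht : 0 < t) (j : ZMod N) : Integrable dens (marginal (F t) j) :=
  (integrable_marginal_iff _ j measurable_dens).2 (hF.integrable_dens t ht j)

/-- Splitting the outflow `ρ_j` by direction pairs it with the inflow into two differences between
adjacent cells. The integrand is linear in the densities, so no independence is required. -/
theorem SolvesMasterEquation.integral_generator_dens (hF : SolvesMasterEquation γ F) {t : ℝ}
    (ht : 0 < t) (j : ZMod N) :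
    ∫ s, generator γ (oneCell j fun _ r => r) s ∂(F t)
      = (meanDensOf (marginal (F t) (j - 1)) 1 - meanDensOf (marginal (F t) j) 1)
        + (meanDensOf (marginal (F t) (j + 1)) (-1) - meanDensOf (marginal (F t) j) (-1)) := by
  have hi : ∀ z k, Integrable (fun s : Config N => densOf z (s k)) (F t) := fun z k =>
    (integrable_marginal_iff _ k (measurable_densOf z)).1
      (integrable_densOf (hF.integrable_marginal ht k) z)
  simp only [meanDensOf_eq_integral, integral_marginal _ _ (measurable_densOf _)]
  rw [← integral_sub (hi _ _) (hi _ _), ← integral_sub (hi _ _) (hi _ _),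
    ← integral_add]
  rotate_left
  · exact (hi _ _).sub (hi _ _)
  · exact (hi _ _).sub (hi _ _)
  refine integral_congr_ae (Eventually.of_forall fun s => ?_)
  simp only [generator_oneCell, ← densOf_add (s j)]
  simp
  ring

theorem SolvesMasterEquation.integral_generator_dir (hF : SolvesMasterEquation γ F)
    (hγ_meas : ∀ j, Measurable (γ j)) (hγ_nonneg : ∀ j s, 0 ≤ γ j s)
    (hchaos : PropagationOfChaos F) {t : ℝ} (ht : 0 < t) (j : ZMod N) :
    ∫ s, generator γ (oneCell j fun z _ => ((z : ℤ) : ℝ)) s ∂(F t)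
      = (1 / (N : ℝ)) * ∫ a, effRate γ (marginal (F t)) j a.1 a.2 * (-2 * dir a)
          ∂(marginal (F t) j) := by
  have := hF.isProbabilityMeasure t ht
  have hm : Measurable fun s : Config N => -2 * dir (s j) :=
    (measurable_dir.comp (measurable_pi_apply j)).const_mul _
  have hintg : Integrable (fun s => γ j s * (-2 * dir (s j))) (F t) := by
    refine ((hF.integrable_rate t ht j).const_mul 2).mono'
      ((hγ_meas j).mul hm).aestronglyMeasurable (Eventually.of_forall fun s => ?_)
    rw [Real.norm_eq_abs, abs_mul, abs_mul, abs_dir, abs_of_nonneg (hγ_nonneg j s)]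
    have := mul_nonneg (hγ_nonneg j s) (dens_nonneg (s j))
    norm_num
    nlinarith
  have hintg' := hintg
  rw [hchaos t ht] at hintg'
  have key := integral_rate_mul (γ := γ) (marginal (F t)) j (κ := fun a => -2 * dir a) hintg'
  rw [← hchaos t ht] at key
  rw [← key, ← integral_const_mul]
  refine integral_congr_ae (Eventually.of_forall fun s => ?_)
  simp only [generator_oneCell]
  simp [dir]
  ring_nf

/-- The inflow comes from other cells, so by independence its expectation factors out of `ψ'`; the
outflow involves the same cell and does not factor. -/
theorem SolvesMasterEquation.integral_generator_of_switch_invariant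
    (hF : SolvesMasterEquation γ F) (hchaos : PropagationOfChaos F) {t : ℝ} (ht : 0 < t)
    (hN : N ≠ 1) (j : ZMod N) {ψ : ℝ → ℝ} (hψ : IsTest fun _ => ψ) :
    ∫ s, generator γ (oneCell j fun _ => ψ) s ∂(F t)
      = (meanDensOf (marginal (F t) (j - 1)) 1 + meanDensOf (marginal (F t) (j + 1)) (-1))
          * ∫ a, deriv ψ (dens a) ∂(marginal (F t) j)
        - ∫ a, dens a * deriv ψ (dens a) ∂(marginal (F t) j) := by
  have := hF.isProbabilityMeasure t ht
  -- For a single cell the neighbours would be the cell itself. For two cells they coincide with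
  -- each other, which does no harm.
  have : Fact (1 < N) := ⟨by have := NeZero.ne N; omega⟩
  have hdm : Measurable fun a => deriv ψ (dens a) := (measurable_deriv ψ).comp measurable_dens
  obtain ⟨-, C, hC⟩ := hψ
  have hb : ∀ {φ : Config N → ℝ}, Integrable φ (F t) →
      Integrable (fun s => φ s * deriv ψ (dens (s j))) (F t) := fun {φ} hφ =>
    hφ.mul_bdd (hdm.comp (measurable_pi_apply j)).aestronglyMeasurable
      (Eventually.of_forall fun s => hC 1 _)
  have hi : ∀ z k, Integrable (fun s : Config N => densOf z (s k)) (F t) := fun z k =>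
    (integrable_marginal_iff _ k (measurable_densOf z)).1
      (integrable_densOf (hF.integrable_marginal ht k) z)
  have hprod : ∀ z k, k ≠ j → ∫ s, densOf z (s k) * deriv ψ (dens (s j)) ∂(F t)
      = meanDensOf (marginal (F t) k) z * ∫ a, deriv ψ (dens a) ∂(marginal (F t) j) := by
    intro z k hk
    have := integral_pi_mul_of_ne (marginal (F t)) hk (measurable_densOf z) hdm
    rw [← hchaos t ht] at this
    rw [this, meanDensOf_eq_integral]
  rw [add_mul, ← hprod 1 (j - 1) (by simp), ← hprod (-1) (j + 1) (by simp),
    integral_marginal _ _ (φ := fun a => dens a * deriv ψ (dens a)) (measurable_dens.mul hdm),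
    ← integral_add (hb (hi _ _)) (hb (hi _ _)), ← integral_sub]
  rotate_left
  · exact (hb (hi _ _)).add (hb (hi _ _))
  · exact hb (hF.integrable_dens t ht j)
  refine integral_congr_ae (Eventually.of_forall fun s => ?_)
  simp only [generator_oneCell]
  simp only [sub_self, mul_zero, add_zero]
  ring

end Marginals

theorem hasDerivAt_rescaled {γ : (N : ℕ+) → ZMod N → Config N → ℝ}
    {F : (N : ℕ+) → ℝ → Measure (Config N)} (hF : ∀ N, SolvesMasterEquation (γ N) (F N))
    {ψ : ℤˣ → ℝ → ℝ} (hψ : IsTest ψ) (N : ℕ+) (j : ZMod N) {t : ℝ} (ht : 0 < t) :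
    HasDerivAt (fun τ => ∫ a, ψ a.1 (dens a) ∂(rescaled F N j τ))
      ((N : ℝ) * ∫ s, generator (γ N) (oneCell j ψ) s ∂(F N ((N : ℝ) * t))) t := by
  have hNpos : (0 : ℝ) < (N : ℝ) := by exact_mod_cast N.pos
  have h := ((hF N).weak_form ((N : ℝ) * t) (mul_pos hNpos ht) j ψ hψ).comp t
    ((hasDerivAt_id t).const_mul (N : ℝ))
  have hm : Measurable fun a : Cell => ψ a.1 (dens a) :=
    measurable_cell (φ := fun z ρ => ψ z ρ) fun z =>
      (hψ.1 z).continuous.measurable.comp measurable_coe_nnreal_real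
  have e : (fun τ => ∫ a, ψ a.1 (dens a) ∂(rescaled F N j τ))
      = (fun τ => ∫ s, evalAt (oneCell j ψ) s ∂(F N τ)) ∘ (fun τ => (N : ℝ) * id τ) := by
    funext τ
    simp only [rescaled, Function.comp_apply, id]
    rw [integral_marginal _ _ hm]
    rfl
  rw [e, mul_comm]
  simpa using h

/-! ### Test functions -/

theorem isTest_dens : IsTest fun _ r => r :=
  ⟨fun _ => contDiff_id, 1, fun _ r => by simp⟩

theorem isTest_dir : IsTest fun z _ => ((z : ℤ) : ℝ) :=
  ⟨fun _ => contDiff_const, 0, fun _ r => by simp⟩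

/-- A smooth convex function of linear growth with its minimum at `c`. -/
def softAbs (c r : ℝ) : ℝ := √(1 + (r - c) ^ 2)

theorem softAbs_pos (c r : ℝ) : 0 < softAbs c r := Real.sqrt_pos.2 (by positivity)

theorem abs_sub_le_softAbs (c r : ℝ) : |r - c| ≤ softAbs c r :=
  Real.abs_le_sqrt (by linarith)

theorem softAbs_le (c r : ℝ) : softAbs c r ≤ 1 + |r - c| := by
  refine Real.sqrt_le_iff.2 ⟨by positivity, ?_⟩
  nlinarith [abs_nonneg (r - c), sq_abs (r - c)]

theorem contDiff_softAbs (c : ℝ) : ContDiff ℝ 1 (softAbs c) := by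
  unfold softAbs
  exact ContDiff.sqrt (by fun_prop) fun r => by positivity

theorem deriv_softAbs (c r : ℝ) : deriv (softAbs c) r = (r - c) / softAbs c r := by
  have h1 : HasDerivAt (fun r : ℝ => 1 + (r - c) ^ 2) (2 * (r - c)) r := by
    simpa using (((hasDerivAt_id r).sub_const c).pow 2).const_add 1
  have h2 := h1.sqrt (by positivity)
  change deriv (fun r => √(1 + (r - c) ^ 2)) r = _
  rw [h2.deriv, softAbs]
  field_simp

theorem abs_deriv_softAbs_le (c r : ℝ) : |deriv (softAbs c) r| ≤ 1 := by
  rw [deriv_softAbs, abs_div, abs_of_pos (softAbs_pos c r), div_le_one (softAbs_pos c r)]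
  exact abs_sub_le_softAbs c r

theorem isTest_softAbs (c : ℝ) : IsTest fun _ => softAbs c :=
  ⟨fun _ => contDiff_softAbs c, 1, fun _ => abs_deriv_softAbs_le c⟩

theorem continuous_deriv_softAbs (c : ℝ) : Continuous (deriv (softAbs c)) :=
  (contDiff_softAbs c).continuous_deriv le_rfl

/-! ### Moments of converging laws -/

theorem eventually_pos_time (x : ℝ) {t : ℝ} (ht : 0 < t) :
    ∀ᶠ q : ℕ+ × ℤ × ℝ in hydroFilter x t, 0 < q.2.2 :=
  (hydroFilter_tendsto_time x t).eventually (lt_mem_nhds ht)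

theorem mul_pnat_pos (N : ℕ+) {t : ℝ} (ht : 0 < t) : 0 < (N : ℝ) * t :=
  mul_pos (by exact_mod_cast N.pos) ht

section Profile

variable {g : Profile} {f : ℝ → ℝ → Measure Cell}

theorem ProfileTendsto.isFiniteMeasure (h : ProfileTendsto g f) (x : ℝ) {t : ℝ} (ht : 0 < t) :
    IsFiniteMeasure (f x t) :=
  isFiniteMeasure_of_integrable (h.integrable x t ht)

theorem ProfileTendsto.integrable_dens (h : ProfileTendsto g f) (x : ℝ) {t : ℝ} (ht : 0 < t) :
    Integrable dens (f x t) :=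
  (h.integrable x t ht).mono' measurable_dens.aestronglyMeasurable
    (Eventually.of_forall fun a => by
      rw [Real.norm_eq_abs, abs_of_nonneg (dens_nonneg a)]; linarith)

theorem ProfileTendsto.isProbabilityMeasure (h : ProfileTendsto g f)
    (hg : ∀ N j t, 0 < t → IsProbabilityMeasure (g N j t)) (x : ℝ) {t : ℝ} (ht : 0 < t) :
    IsProbabilityMeasure (f x t) := by
  have := h.isFiniteMeasure x ht
  have T := h.tendsto (fun _ _ => 1) (fun _ => continuous_const)
    ⟨1, fun z ρ => by simp⟩ x t ht
  have T' : Tendsto (fun q : ℕ+ × ℤ × ℝ =>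
      ∫ _, (1 : ℝ) ∂(g q.1 (q.2.1 : ZMod q.1) q.2.2)) (hydroFilter x t) (𝓝 1) := by
    refine tendsto_const_nhds.congr' ?_
    filter_upwards [eventually_pos_time x ht] with q hq
    have := hg q.1 q.2.1 q.2.2 hq
    simp
  have e := tendsto_nhds_unique T T'
  simp only [integral_const, smul_eq_mul, mul_one] at e
  exact ⟨by rw [← ofReal_measureReal (h := measure_ne_top _ _), e, ENNReal.ofReal_one]⟩

theorem ProfileTendsto.meanDensOf (h : ProfileTendsto g f) (z : ℤˣ) :
    GridTendsto (fun N j t => meanDensOf (g N j t) z) (fun x t => meanDensOf (f x t) z) := by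
  simp only [meanDensOf_eq_integral]
  refine h.tendsto (fun w ρ => if w = z then (ρ : ℝ) else 0) (fun w => ?_) ⟨1, fun w ρ => ?_⟩
  · by_cases hw : w = z
    · simpa [hw] using NNReal.continuous_coe
    · simpa [hw] using continuous_const
  · have := abs_densOf_le z (w, ρ)
    simp only [densOf, dens] at this
    linarith

theorem ProfileTendsto.meanDens (h : ProfileTendsto g f) :
    GridTendsto (fun N j t => meanDens (g N j t)) (fun x t => meanDens (f x t)) :=
  fun x t ht => (h.meanDensOf 1 x t ht).add (h.meanDensOf (-1) x t ht)

theorem ProfileTendsto.velocity (h : ProfileTendsto g f) :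
    GridTendsto (fun N j t => velocity (g N j t)) (fun x t => velocity (f x t)) := by
  have hp : ∀ z, GridTendsto (fun N j t => prob (g N j t) z) (fun x t => prob (f x t) z) := by
    intro z
    simp only [prob_eq_integral]
    refine h.tendsto (fun w _ => if w = z then 1 else 0) (fun w => continuous_const)
      ⟨1, fun w ρ => ?_⟩
    have := ρ.2
    split_ifs <;> simp
    positivity
  exact fun x t ht => (hp 1 x t ht).sub (hp (-1) x t ht)

end Profile

/-! ### The hydrodynamic limit -/

section Limit

variable {γ : (N : ℕ+) → ZMod N → Config N → ℝ} {F : (N : ℕ+) → ℝ → Measure (Config N)}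
  {f : ℝ → ℝ → Measure Cell}

theorem isProbabilityMeasure_rescaled (hF : ∀ N, SolvesMasterEquation (γ N) (F N)) (N : ℕ+)
    (j : ZMod N) {t : ℝ} (ht : 0 < t) : IsProbabilityMeasure (rescaled F N j t) :=
  have := (hF N).isProbabilityMeasure _ (mul_pnat_pos N ht)
  isProbabilityMeasure_marginal _ j

/-- The limit laws are concentrated on the mean density. -/
theorem ae_eq_meanDens (hF : ∀ N, SolvesMasterEquation (γ N) (F N))
    (hchaos : ∀ N, PropagationOfChaos (F N)) (hf : ProfileTendsto (rescaled F) f) (x : ℝ) {t : ℝ}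
    (ht : 0 < t) : ∀ᵐ a ∂(f x t), a.2 = (meanDens (f x t)).toNNReal := by
  -- The centre is frozen at the given `(x, t)`, and the limit identity is evaluated only there. A
  -- quadratic test function is unavailable, because its derivative is unbounded and only linear
  -- growth passes to the limit; hence `softAbs`.
  set c := meanDens (f x t) with hc
  set ψ' := deriv (softAbs c) with hψ'
  have hcψ : Continuous ψ' := continuous_deriv_softAbs c
  have hbψ : ∀ r, |ψ' r| ≤ 1 := abs_deriv_softAbs_le c
  have h0 : ∀ ρ : ℝ≥0, (0 : ℝ) ≤ ρ := fun ρ => ρ.2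
  have lin0 : ∀ (z : ℤˣ) (ρ : ℝ≥0), |softAbs c ρ| ≤ (1 + |c|) * (1 + (ρ : ℝ)) := fun _ ρ => by
    rw [abs_of_pos (softAbs_pos c ρ)]
    have h1 := softAbs_le c ρ
    have h2 := abs_sub (ρ : ℝ) c
    rw [abs_of_nonneg (h0 ρ)] at h2
    nlinarith [abs_nonneg c, h0 ρ, mul_nonneg (abs_nonneg c) (h0 ρ)]
  have lin1 : ∀ (z : ℤˣ) (ρ : ℝ≥0), |ψ' ρ| ≤ 1 * (1 + (ρ : ℝ)) := fun _ ρ => by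
    linarith [hbψ ρ, h0 ρ]
  have lin2 : ∀ (z : ℤˣ) (ρ : ℝ≥0), |ρ * ψ' ρ| ≤ 1 * (1 + (ρ : ℝ)) := fun _ ρ => by
    rw [abs_mul, abs_of_nonneg (h0 ρ)]
    nlinarith [hbψ ρ, h0 ρ]
  have T0 := hf.tendsto (fun _ ρ => softAbs c ρ)
    (fun _ => (contDiff_softAbs c).continuous.comp NNReal.continuous_coe) ⟨_, lin0⟩
  have T1 := hf.tendsto (fun _ ρ => ψ' ρ) (fun _ => hcψ.comp NNReal.continuous_coe) ⟨_, lin1⟩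
  have T2 := hf.tendsto (fun _ ρ => ρ * ψ' ρ)
    (fun _ => NNReal.continuous_coe.mul (hcψ.comp NNReal.continuous_coe)) ⟨_, lin2⟩
  have Tm : GridTendsto (fun N j s => Sweeping.meanDensOf (rescaled F N (j - 1) s) 1
      + Sweeping.meanDensOf (rescaled F N (j + 1) s) (-1)) (fun y s => meanDens (f y s)) := by
    intro y s hs
    have A := (hf.meanDensOf 1).comp_shift (-1) y s hs
    have B := (hf.meanDensOf (-1)).comp_shift 1 y s hs
    simpa [sub_eq_add_neg, Sweeping.meanDens] using A.add B
  have key := T0.tendsto_deriv_div_eq_zero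
    (a' := fun N j s => (Sweeping.meanDensOf (rescaled F N (j - 1) s) 1
      + Sweeping.meanDensOf (rescaled F N (j + 1) s) (-1)) * (∫ a, ψ' a.2 ∂(rescaled F N j s))
      - ∫ a, a.2 * ψ' a.2 ∂(rescaled F N j s))
    (c := fun y s => meanDens (f y s) * (∫ a, ψ' a.2 ∂(f y s)) - ∫ a, a.2 * ψ' a.2 ∂(f y s))
    (fun y s hs => ((Tm y s hs).mul (T1 y s hs)).sub (T2 y s hs)) ?_ x ht
  · have i1 := integrable_of_linear_growth (hf.integrable x t ht) (φ := fun _ ρ => ψ' ρ)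
      (fun _ => (hcψ.comp NNReal.continuous_coe).measurable) lin1
    have i2 := integrable_of_linear_growth (hf.integrable x t ht) (φ := fun _ ρ => ρ * ψ' ρ)
      (fun _ => (NNReal.continuous_coe.mul (hcψ.comp NNReal.continuous_coe)).measurable) lin2
    simp only [← hc] at key
    rw [← integral_const_mul, ← integral_sub (i1.const_mul c) i2] at key
    -- The integrand is `(r - c)² / softAbs c r`, so its vanishing integral forces `r = c` almost
    -- everywhere.
    have hnn : ∀ r, 0 ≤ r * ψ' r - c * ψ' r := fun r => by
      rw [hψ', deriv_softAbs, ← sub_mul, ← mul_div_assoc]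
      exact div_nonneg (mul_self_nonneg _) (softAbs_pos c r).le
    have key' : ∫ a : Cell, (a.2 * ψ' a.2 - c * ψ' a.2) ∂(f x t) = 0 := by
      rw [← neg_eq_zero, ← integral_neg]
      simpa using key
    rw [integral_eq_zero_iff_of_nonneg (fun a : Cell => hnn a.2) (i2.sub (i1.const_mul c))] at key'
    filter_upwards [key'] with a ha
    simp only [Pi.zero_apply] at ha
    rw [hψ', deriv_softAbs, ← sub_mul, ← mul_div_assoc, div_eq_zero_iff] at ha
    have hac : (a.2 : ℝ) = c := by
      rcases ha with ha | ha
      · linarith [mul_self_eq_zero.1 ha]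
      · exact absurd ha (softAbs_pos c a.2).ne'
    rw [← hac, Real.toNNReal_coe]
  · filter_upwards [eventually_ge_atTop 2] with N hN j s hs
    have hN1 : (N : ℕ) ≠ 1 := by
      have : (2 : ℕ) ≤ N := by exact_mod_cast hN
      omega
    have h := hasDerivAt_rescaled hF (isTest_softAbs c) N j hs
    rw [(hF N).integral_generator_of_switch_invariant (hchaos N) (mul_pnat_pos N hs) hN1 j
      (isTest_softAbs c)] at h
    exact h

theorem meanDensOf_eq_prob_mul {μ : Measure Cell} [IsFiniteMeasure μ]
    (hμ : Integrable dens μ) (h : ∀ᵐ a ∂μ, a.2 = (meanDens μ).toNNReal) (z : ℤˣ) :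
    meanDensOf μ z = prob μ z * meanDens μ := by
  rw [meanDensOf, component_eq_dirac h z, integral_smul_measure, integral_dirac,
    ENNReal.toReal_ofReal (prob_nonneg μ z), Real.coe_toNNReal _ (meanDens_nonneg hμ),
    smul_eq_mul]

/-- Right-movers arrive from cell `j - 1`, giving minus a forward quotient shifted by one cell;
left-movers arrive from `j + 1`, giving a forward quotient. Neither chaos nor monokineticity enters.
-/
theorem hasDerivAt_meanDens (hF : ∀ N, SolvesMasterEquation (γ N) (F N))
    (hf : ProfileTendsto (rescaled F) f) {D : ℤˣ → ℝ → ℝ → ℝ}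
    (hD : ∀ z, GridTendsto (fun N j t => (meanDensOf (rescaled F N (j + 1) t) z
      - meanDensOf (rescaled F N j t) z) / (1 / (N : ℝ))) (D z)) (x : ℝ) {t : ℝ} (ht : 0 < t) :
    HasDerivAt (fun τ => meanDens (f x τ)) (-(D 1 x t - D (-1) x t)) t := by
  have hd : ∀ N j t, 0 < t → HasDerivAt (fun τ => meanDens (rescaled F N j τ))
      ((N : ℝ) * ∫ s, generator (γ N) (oneCell j fun _ r => r) s ∂(F N ((N : ℝ) * t))) t := by
    intro N j t ht
    refine (hasDerivAt_rescaled hF isTest_dens N j ht).congr_of_eventuallyEq ?_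
    filter_upwards [lt_mem_nhds ht] with s hs
    exact meanDens_eq_integral ((hF N).integrable_marginal (mul_pnat_pos N hs) j)
  refine hf.meanDens.hasDerivAt_time (c := fun x t => -(D 1 x t - D (-1) x t)) ?_ hd x ht
  intro y s hs
  have A := (hD 1).comp_shift (-1) y s hs
  have B := hD (-1) y s hs
  have e : -(D 1 y s - D (-1) y s) = -D 1 y s + D (-1) y s := by ring
  simp only [e]
  refine (A.neg.add B).congr' ?_
  filter_upwards [eventually_pos_time y hs] with q hq
  rw [(hF q.1).integral_generator_dens (mul_pnat_pos q.1 hq)]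
  simp only [rescaled, Int.cast_neg, Int.cast_one, neg_add_cancel_right, sub_eq_add_neg]
  field_simp
  ring

variable {γbar : ℝ → ℤˣ → ℝ≥0 → ℝ → ℝ}

theorem limitRate_nonneg {g : Profile} (hγ_nonneg : ∀ N j s, 0 ≤ γ N j s)
    (hγbar : RateTendsto γ g γbar) (z : ℤˣ) (x : ℝ) {t : ℝ} (ht : 0 < t) :
    0 ≤ limitRate γbar f z x t :=
  ge_of_tendsto (hγbar x t z _ ht)
    (Eventually.of_forall fun q => effRate_nonneg (hγ_nonneg q.1.1) _ _ _ _)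

/-- Convergence of the switching terms: near the mean density the effective rates are close to
their limit, and away from it their linear growth is controlled by the converging laws. -/
theorem gridTendsto_switching {g : Profile} (hγ_meas : ∀ N j, Measurable (γ N j))
    (hγ_nonneg : ∀ N j s, 0 ≤ γ N j s)
    (hg : ∀ N j t, 0 < t → IsProbabilityMeasure (g N j t) ∧ Integrable dens (g N j t))
    (hf : ProfileTendsto g f) (hγbar : MeanFieldLimit γ g γbar)
    (hmono : ∀ x t, 0 < t → ∀ᵐ a ∂(f x t), a.2 = (meanDens (f x t)).toNNReal) :
    GridTendsto
      (fun N j t => ∫ a, effRate (γ N) (fun i => g N i t) j a.1 a.2 * (-2 * dir a) ∂(g N j t))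
      (fun x t => ∑ z : ℤˣ, prob (f x t) z * (limitRate γbar f z x t * (-2 * ((z : ℤ) : ℝ)))) := by
  intro x t ht
  have := hf.isFiniteMeasure x ht
  have hfp := hf.isProbabilityMeasure (fun N j t ht => (hg N j t ht).1) x ht
  set c := (meanDens (f x t)).toNNReal with hc
  set G : ℤˣ → ℝ := fun z => limitRate γbar f z x t with hG
  have hG0 : ∀ z, 0 ≤ G z := fun z => limitRate_nonneg hγ_nonneg hγbar.tendsto z x ht
  have hdir : ∀ z : ℤˣ, |((z : ℤ) : ℝ)| = 1 := fun z => abs_dir (z, 0)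
  have hGle : ∀ z, G z ≤ G 1 + G (-1) := fun z => by
    rcases Int.units_eq_one_or z with h | h <;> rw [h] <;> linarith [hG0 1, hG0 (-1)]
  have linG : ∀ (z : ℤˣ) (ρ : ℝ≥0),
      |G z * (-2 * ((z : ℤ) : ℝ))| ≤ (2 * (G 1 + G (-1))) * (1 + (ρ : ℝ)) := fun z ρ => by
    rw [abs_mul, abs_mul, hdir, abs_of_nonneg (hG0 z)]
    norm_num
    nlinarith [hGle z, hG0 1, hG0 (-1), mul_nonneg (add_nonneg (hG0 1) (hG0 (-1))) ρ.2]
  -- With the rate frozen at its limit value at density `c`, convergence of the laws is enough; what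
  -- remains is to show that freezing costs less than `ε`.
  have T := hf.tendsto (fun z _ => G z * (-2 * ((z : ℤ) : ℝ))) (fun _ => continuous_const)
    ⟨_, linG⟩ x t ht
  beta_reduce at T
  rw [integral_eq_sum_prob (hmono x t ht) (fun z _ => G z * (-2 * ((z : ℤ) : ℝ)))] at T
  refine T.congr_dist (Metric.tendsto_nhds.2 fun ε hε => ?_)
  obtain ⟨C, hC⟩ := hγbar.growth x t ht
  -- Away from `c`, the difference of the rates is at most `C' (1 + ρ)`, by the growth bound and the
  -- size of `G`.
  set C' : ℝ := |C| + (G 1 + G (-1)) with hC'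
  have hC'0 : 0 ≤ C' := add_nonneg (abs_nonneg C) (add_nonneg (hG0 1) (hG0 (-1)))
  -- the rates are uniformly close to their limit near the mean density
  have hnear : ∃ η > 0, ∀ᶠ q in hydroFilter x t, ∀ (z : ℤˣ) (ρ : ℝ≥0), |(ρ : ℝ) - c| < η →
      |effRate (γ q.1) (fun i => g q.1 i q.2.2) (q.2.1 : ZMod q.1) z ρ - G z| ≤ ε / 8 := by
    have hall := eventually_all.2 fun z : ℤˣ =>
      Metric.tendsto_nhds.1 (hγbar.tendsto x t z c ht) (ε / 8) (by positivity)
    obtain ⟨pa, ha, pb, hb, hab⟩ := eventually_prod_iff.1 hall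
    obtain ⟨η, hη, hball⟩ := Metric.eventually_nhds_iff.1 hb
    refine ⟨η, hη, ha.mono fun q hq z ρ hρ => ?_⟩
    exact (hab hq (hball (by rwa [NNReal.dist_eq])) z).le
  obtain ⟨η, hη, hnear⟩ := hnear
  -- A continuous majorant of linear growth for the rate error: at least `ε / 8` near `c`, at least
  -- `C' (1 + ρ)` beyond distance `η`, and equal to `ε / 8` at `c`. So its integrals tend to `ε /
  -- 8`, are eventually below `ε / 4`, and the factor `|-2 z| = 2` leaves `ε / 2`.
  set K : ℝ≥0 → ℝ := fun ρ => ε / 8 + C' * (1 + (ρ : ℝ)) * min 1 (|(ρ : ℝ) - c| / η) with hK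
  have hKc : Continuous K := by fun_prop
  have hmin : ∀ ρ : ℝ≥0, 0 ≤ min 1 (|(ρ : ℝ) - c| / η) := fun ρ =>
    le_min zero_le_one (by positivity)
  have hK0 : ∀ ρ, 0 ≤ K ρ := fun ρ =>
    add_nonneg (by positivity) (mul_nonneg (by positivity) (hmin ρ))
  have linK : ∀ (z : ℤˣ) (ρ : ℝ≥0), |K ρ| ≤ (ε / 8 + C') * (1 + (ρ : ℝ)) := fun z ρ => by
    rw [abs_of_nonneg (hK0 ρ)]
    have h1 : C' * (1 + (ρ : ℝ)) * min 1 (|(ρ : ℝ) - c| / η) ≤ C' * (1 + (ρ : ℝ)) * 1 :=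
      mul_le_mul_of_nonneg_left (min_le_left _ _) (by positivity)
    have h2 : 0 ≤ ε / 8 * (ρ : ℝ) := by positivity
    simp only [hK]
    nlinarith
  have TK := hf.tendsto (fun _ => K) (fun _ => hKc) ⟨_, linK⟩ x t ht
  have hKint : ∫ a, K a.2 ∂(f x t) = ε / 8 := by
    rw [integral_eq_sum_prob (hmono x t ht) (fun _ => K), ← Finset.sum_mul, sum_intUnits, sum_prob]
    simp [hK, hc]
  simp only [hKint] at TK
  have hKev := TK.eventually (gt_mem_nhds (show ε / 8 < ε / 4 by linarith))
  filter_upwards [hnear, hC, hKev, eventually_pos_time x ht] with q hq1 hq2 hq3 hq4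
  obtain ⟨hp, hi⟩ := hg q.1 q.2.1 q.2.2 hq4
  have := fun i => (hg q.1 i q.2.2 hq4).1
  set ν := g q.1 (q.2.1 : ZMod q.1) q.2.2 with hν
  have hi1 : Integrable (fun a => 1 + dens a) ν := (integrable_const 1).add hi
  set E : Cell → ℝ := fun a =>
    effRate (γ q.1) (fun i => g q.1 i q.2.2) (q.2.1 : ZMod q.1) a.1 a.2 with hE
  have hE0 : ∀ a, 0 ≤ E a := fun a => effRate_nonneg (hγ_nonneg q.1) _ _ _ _
  have hEm : Measurable E := measurable_effRate (hγ_meas q.1) _ _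
  have hEK : ∀ a, |E a - G a.1| ≤ K a.2 := by
    intro a
    by_cases ha : |(a.2 : ℝ) - c| < η
    · refine (hq1 a.1 a.2 ha).trans ?_
      have := mul_nonneg (mul_nonneg hC'0 (show (0 : ℝ) ≤ 1 + a.2 by positivity)) (hmin a.2)
      simp only [hK]
      linarith
    · have h1 : min 1 (|(a.2 : ℝ) - c| / η) = 1 :=
        min_eq_left ((one_le_div hη).2 (not_lt.1 ha))
      have h2 : E a ≤ |C| * (1 + (a.2 : ℝ)) := (hq2 a.1 a.2).trans
        (mul_le_mul_of_nonneg_right (le_abs_self C) (by positivity))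
      have h3 : (0 : ℝ) ≤ a.2 := a.2.2
      have h4 := mul_nonneg (add_nonneg (hG0 1) (hG0 (-1))) h3
      have h5 := mul_nonneg (abs_nonneg C) h3
      simp only [hK, h1, hC', mul_one]
      rw [abs_le]
      constructor <;> nlinarith [hE0 a, hG0 a.1, hGle a.1, abs_nonneg C]
  have iK : Integrable (fun a : Cell => K a.2) ν :=
    integrable_of_linear_growth hi1 (φ := fun _ => K) (fun _ => hKc.measurable) linK
  have iG : Integrable (fun a : Cell => G a.1 * (-2 * dir a)) ν :=
    integrable_of_linear_growth hi1 (φ := fun z _ => G z * (-2 * ((z : ℤ) : ℝ)))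
      (fun _ => measurable_const) linG
  have hGm : Measurable fun a : Cell => G a.1 :=
    measurable_cell (φ := fun z _ => G z) fun _ => measurable_const
  have hdm : Measurable fun a : Cell => -2 * dir a := measurable_dir.const_mul _
  have hbd : ∀ a, ‖(E a - G a.1) * (-2 * dir a)‖ ≤ 2 * K a.2 := fun a => by
    rw [Real.norm_eq_abs, abs_mul, abs_mul, abs_dir]
    norm_num
    linarith [hEK a]
  have iD : Integrable (fun a : Cell => (E a - G a.1) * (-2 * dir a)) ν :=
    (iK.const_mul 2).mono' ((hEm.sub hGm).mul hdm).aestronglyMeasurable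
      (Eventually.of_forall hbd)
  have hsum : ∫ a, E a * (-2 * dir a) ∂ν
      = ∫ a, G a.1 * (-2 * dir a) ∂ν + ∫ a, (E a - G a.1) * (-2 * dir a) ∂ν := by
    rw [← integral_add iG iD]
    exact integral_congr_ae (Eventually.of_forall fun a => by ring)
  have hle := norm_integral_le_of_norm_le (iK.const_mul 2) (Eventually.of_forall hbd)
  rw [integral_const_mul] at hle
  change dist (dist (∫ a, G a.1 * (-2 * dir a) ∂ν) (∫ a, E a * (-2 * dir a) ∂ν)) 0 < ε
  rw [hsum, dist_zero_right, Real.norm_of_nonneg dist_nonneg, dist_self_add_right]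
  linarith

theorem hasDerivAt_velocity (hγ_meas : ∀ N j, Measurable (γ N j))
    (hγ_nonneg : ∀ N j s, 0 ≤ γ N j s) (hF : ∀ N, SolvesMasterEquation (γ N) (F N))
    (hchaos : ∀ N, PropagationOfChaos (F N)) (hf : ProfileTendsto (rescaled F) f)
    (hγbar : MeanFieldLimit γ (rescaled F) γbar) (x : ℝ) {t : ℝ} (ht : 0 < t) :
    HasDerivAt (fun τ => velocity (f x τ))
      (∑ z : ℤˣ, prob (f x t) z * (limitRate γbar f z x t * (-2 * ((z : ℤ) : ℝ)))) t := by
  refine hf.velocity.hasDerivAt_time (gridTendsto_switching hγ_meas hγ_nonneg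
    (fun N j t ht => ⟨isProbabilityMeasure_rescaled hF N j ht,
      (hF N).integrable_marginal (mul_pnat_pos N ht) j⟩) hf hγbar
    fun x t ht => ae_eq_meanDens hF hchaos hf x ht) ?_ x ht
  intro N j t ht
  have h := hasDerivAt_rescaled hF isTest_dir N j ht
  rw [(hF N).integral_generator_dir (hγ_meas N) (hγ_nonneg N) (hchaos N) (mul_pnat_pos N ht),
    ← mul_assoc, mul_one_div_cancel (by simp), one_mul] at h
  refine h.congr_of_eventuallyEq ?_
  filter_upwards [lt_mem_nhds ht] with s hs
  have := isProbabilityMeasure_rescaled hF N j hs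
  exact velocity_eq_integral _

/-- If the total rate vanishes, nonnegativity makes both rates zero, so the value of `0 / 0` does
not matter. -/
theorem relaxation_eq {g₁ g₂ u p₁ p₂ : ℝ} (h₁ : 0 ≤ g₁) (h₂ : 0 ≤ g₂) (hp : p₁ + p₂ = 1)
    (hu : u = p₁ - p₂) :
    p₁ * (g₁ * -2) + p₂ * (g₂ * 2) = (g₂ + g₁) * ((g₂ - g₁) / (g₂ + g₁) - u) := by
  rcases (add_nonneg h₂ h₁).eq_or_lt with h | h
  · have e₁ : g₁ = 0 := by linarith
    have e₂ : g₂ = 0 := by linarith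
    simp [e₁, e₂]
  · rw [mul_sub, mul_div_cancel₀ _ h.ne', hu]
    linear_combination (g₂ - g₁) * hp

/-! ### The monokinetic laws on the grid -/

theorem integral_diracProfile (N : ℕ+) (i : ZMod N) (t : ℝ) (φ : ℤˣ → ℝ≥0 → ℝ) :
    ∫ a, φ a.1 a.2 ∂(diracProfile f N i t)
      = ∑ z, prob (f ((i.val : ℝ) / (N : ℝ)) t) z
          * φ z (meanDens (f ((i.val : ℝ) / (N : ℝ)) t)).toNNReal := by
  rw [diracProfile, integral_finsetSum_measure]
  · refine Finset.sum_congr rfl fun z _ => ?_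
    rw [integral_smul_measure, integral_dirac, ENNReal.toReal_ofReal (prob_nonneg _ z),
      smul_eq_mul]
  · exact fun z _ => (integrable_dirac (by simp)).smul_measure ENNReal.ofReal_ne_top

theorem diracProfile_isProbabilityMeasure (hf : ∀ x t, 0 < t → IsProbabilityMeasure (f x t))
    (N : ℕ+) (i : ZMod N) {t : ℝ} (ht : 0 < t) :
    IsProbabilityMeasure (diracProfile f N i t) := by
  have := hf ((i.val : ℝ) / (N : ℝ)) t ht
  constructor
  rw [diracProfile, sum_intUnits]
  simp only [Measure.add_apply, Measure.smul_apply, measure_univ, smul_eq_mul, mul_one]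
  rw [← ENNReal.ofReal_add (prob_nonneg _ _) (prob_nonneg _ _), sum_prob, ENNReal.ofReal_one]

theorem integrable_diracProfile (N : ℕ+) (i : ZMod N) (t : ℝ) :
    Integrable dens (diracProfile f N i t) := by
  rw [diracProfile, integrable_finsetSum_measure]
  exact fun z _ => (integrable_dirac (by simp)).smul_measure ENNReal.ofReal_ne_top

/-- Since `f` is monokinetic, testing the grid law at `x_i` gives the same as testing `f x_i`, so
convergence is continuity of `x, t ↦ ⟨f x t, φ⟩`. -/
theorem profileTendsto_diracProfile {g : Profile} (hf : ProfileTendsto g f)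
    (hmono : ∀ x t, 0 < t → ∀ᵐ a ∂(f x t), a.2 = (meanDens (f x t)).toNNReal) :
    ProfileTendsto (diracProfile f) f where
  integrable := hf.integrable
  tendsto φ hφ hC x t ht := by
    have h := hf.tendsto φ hφ hC
    have T := (h.continuousAt x ht).tendsto.comp
      ((hydroFilter_tendsto_pos x t).prodMk_nhds (hydroFilter_tendsto_time x t))
    refine T.congr' ?_
    filter_upwards [eventually_pos_time x ht] with q hq
    have := hf.isFiniteMeasure (((q.2.1 : ZMod q.1).val : ℝ) / (q.1 : ℝ)) hq
    rw [integral_diracProfile, ← integral_eq_sum_prob (hmono _ _ hq)]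
    have hval : (((q.2.1 : ZMod q.1).val : ℤ)) = q.2.1 % ((q.1 : ℕ) : ℤ) := ZMod.val_intCast _
    have hN : ((q.1 : ℕ) : ℝ) ≠ 0 := by simp
    -- The representative `val` lies in `[0, N)`, so its grid point differs from `j / N` by an
    -- integer, which periodicity removes.
    have e : (q.2.1 : ℝ) / (q.1 : ℝ) = ((q.2.1 : ZMod q.1).val : ℝ) / (q.1 : ℝ)
        + ((q.2.1 / ((q.1 : ℕ) : ℤ) : ℤ) : ℝ) * 1 := by
      have h1 : (((q.2.1 : ZMod q.1).val : ℤ) : ℝ) + ((q.1 : ℕ) : ℝ)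
          * ((q.2.1 / ((q.1 : ℕ) : ℤ) : ℤ) : ℝ) = (q.2.1 : ℝ) := by
        rw [hval]
        exact_mod_cast Int.emod_add_mul_ediv q.2.1 ((q.1 : ℕ) : ℤ)
      rw [← h1]
      push_cast
      field_simp
    simp only [Function.comp_apply]
    rw [e]
    exact (h.periodic hq).int_mul _ _

end Limit

end Sweeping

end

theorem mainTheorem1
    (γ : (N : ℕ+) → ZMod N → Sweeping.Config N → ℝ)
    (hγ_meas : ∀ N j, Measurable (γ N j))
    (hγ_nonneg : ∀ N j s, 0 ≤ γ N j s)
    (F : (N : ℕ+) → ℝ → Measure (Sweeping.Config N))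
    (hF : ∀ N, Sweeping.SolvesMasterEquation (γ N) (F N))
    (hchaos : ∀ N, Sweeping.PropagationOfChaos (F N))
    (f : ℝ → ℝ → Measure Sweeping.Cell)
    (hf : Sweeping.SmoothTendsto (Sweeping.rescaled F) f)
    (γbar : ℝ → ℤˣ → ℝ≥0 → ℝ → ℝ)
    (hγbar : Sweeping.MeanFieldLimit γ (Sweeping.rescaled F) γbar) :
    (∀ x t : ℝ, 0 < t →
      -- the limit law is monokinetic
      (∀ z : ℤˣ, Sweeping.component (f x t) z =
        ENNReal.ofReal (Sweeping.prob (f x t) z) •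
          Measure.dirac (Sweeping.meanDens (f x t)).toNNReal) ∧
      -- continuity equation
      DifferentiableAt ℝ (fun y => Sweeping.meanDens (f y t) * Sweeping.velocity (f y t)) x ∧
      HasDerivAt (fun τ => Sweeping.meanDens (f x τ))
        (-deriv (fun y => Sweeping.meanDens (f y t) * Sweeping.velocity (f y t)) x) t ∧
      -- relaxation of the velocity
      HasDerivAt (fun τ => Sweeping.velocity (f x τ))
        (Sweeping.totalRate γbar f x t *
          (Sweeping.collVelocity γbar f x t - Sweeping.velocity (f x t))) t ∧
      Sweeping.prob (f x t) 1 = (1 + Sweeping.velocity (f x t)) / 2 ∧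
      Sweeping.prob (f x t) (-1) = (1 - Sweeping.velocity (f x t)) / 2) ∧
    -- the limiting rates in terms of the monokinetic law
    (Sweeping.MeanFieldStable γ f γbar →
      Sweeping.RateTendsto γ (Sweeping.diracProfile f) γbar) := by
  have hft := hf.toProfileTendsto
  have hprob : ∀ x t, 0 < t → IsProbabilityMeasure (f x t) := fun x t ht =>
    hft.isProbabilityMeasure
      (fun N j t ht => Sweeping.isProbabilityMeasure_rescaled hF N j ht) x ht
  have hmono : ∀ x t, 0 < t → ∀ᵐ a ∂(f x t), a.2 = (Sweeping.meanDens (f x t)).toNNReal :=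
    fun x t ht => Sweeping.ae_eq_meanDens hF hchaos hft x ht
  refine ⟨fun x t ht => ?_, fun hstable => hstable _ (fun N j t ht =>
    ⟨Sweeping.diracProfile_isProbabilityMeasure hprob N j ht,
      Sweeping.integrable_diracProfile N j t⟩)
    (Sweeping.profileTendsto_diracProfile hft hmono)⟩
  have := hprob x t ht
  have hsum := Sweeping.sum_prob (f x t)
  choose D hD using hf.space_deriv
  -- Differentiability in space is known only for `ρ̄_±`; monokineticity, through `ρ̄_± = p_± ρ̄`,
  -- transfers it to `ρ̄ u`.
  have hflux : (fun y => Sweeping.meanDens (f y t) * Sweeping.velocity (f y t))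
      = fun y => Sweeping.meanDensOf (f y t) 1 - Sweeping.meanDensOf (f y t) (-1) := by
    funext y
    have := hprob y t ht
    have hi := hft.integrable_dens y ht
    rw [Sweeping.meanDensOf_eq_prob_mul hi (hmono y t ht),
      Sweeping.meanDensOf_eq_prob_mul hi (hmono y t ht), Sweeping.velocity]
    ring
  have hspace : HasDerivAt (fun y => Sweeping.meanDens (f y t) * Sweeping.velocity (f y t))
      (D 1 x t - D (-1) x t) x := by
    rw [hflux]
    exact ((hft.meanDensOf 1).hasDerivAt_space (hD 1) x ht).sub
      ((hft.meanDensOf (-1)).hasDerivAt_space (hD (-1)) x ht)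
  refine ⟨Sweeping.component_eq_dirac (hmono x t ht), hspace.differentiableAt, ?_, ?_, ?_, ?_⟩
  · rw [hspace.deriv]
    exact Sweeping.hasDerivAt_meanDens hF hft hD x ht
  · have h := Sweeping.hasDerivAt_velocity hγ_meas hγ_nonneg hF hchaos hft hγbar x ht
    rw [Sweeping.sum_intUnits] at h
    have hr := Sweeping.relaxation_eq
      (Sweeping.limitRate_nonneg (f := f) hγ_nonneg hγbar.tendsto 1 x ht)
      (Sweeping.limitRate_nonneg (f := f) hγ_nonneg hγbar.tendsto (-1) x ht) hsum
      (u := Sweeping.velocity (f x t)) rfl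
    rw [Sweeping.totalRate, Sweeping.collVelocity, ← hr]
    simpa using h
  · rw [Sweeping.velocity]; linarith
  · rw [Sweeping.velocity]; linarith
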